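/- All systems are finite-dimensional, $\mathcal S(B)$ denotes the set of density operators on $\mathcal H_B$, and $\log$ is the logarithm to base $2$. Let $\mathcal N_{A'\to B}$ be a quantum channel (a completely positive trace-preserving linear map), let $\{q(t),\psi^t_{AA'}\}_{t\in\mathcal T}$ be an ensemble of (pure or mixed) bipartite quantum states with $\mathcal T$ finite and $q$ a probability distribution on $\mathcal T$, and let $R\ge 0$ be real. Write $\mathcal N(\psi^t_{AA'})$ for $(\mathrm{id}_A\otimes\mathcal N)(\psi^t_{AA'})$, write $\psi^t_A$ and $\tau_B$ for reduced states, and put $x_+:=\max\{0,x\}$. The relative entropy is $D(\rho\|\sigma)=\operatorname{tr}\rho(\log\rho-\log\sigma)$ if $\operatorname{supp}\rho\subseteq\operatorname{supp}\sigma$, and $+\infty$ otherwise. For $\alpha>1$, a state $\rho$ and a positive semidefinite $\sigma$, the log-Euclidean Rényi divergence is $$D^\flat_\alpha(\rho\|\sigma)=\frac1{\alpha-1}\log\operatorname{tr}2^{\alpha\log\rho+(1-\alpha)\log\sigma}$$ if $\rho$ and $\sigma$ are of full rank; otherwise the trace is replaced by $\lim_{\epsilon\searrow0}\operatorname{tr}2^{\alpha\log(\rho+\epsilon\mathbf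 1)+(1-\alpha)\log(\sigma+\epsilon\mathbf 1)}\in[0,\infty]$. Define $$I^\flat_\alpha\big(\mathcal N,\{q(t),\psi^t\}_t\big)=\sum_{t\in\mathcal T}q(t)\min_{\sigma_B\in\mathcal S(B)}D^\flat_\alpha\big(\mathcal N(\psi^t_{AA'})\,\big\|\,\psi^t_A\otimes\sigma_B\big).$$ Then $$\sup_{\alpha>1}\frac{\alpha-1}{\alpha}\Big(R-I^\flat_\alpha\big(\mathcal N,\{q(t),\psi^t\}_t\big)\Big)=\inf_{\{\tau^t_{AB}\}_t\in\mathcal F}\Big\{\Big(R-\sum_{t}q(t)D(\tau^t_{AB}\|\psi^t_A\otimes\tau^t_B)\Big)_++\sum_{t}q(t)D\big(\tau^t_{AB}\|\mathcal N(\psi^t_{AA'})\big)\Big\},$$ where $\mathcal F$ is the set of all families $\{\tau^t_{AB}\}_{t\in\mathcal T}$ of states on $\mathcal H_A\otimes\mathcal H_B$ with $\operatorname{supp}\tau^t_{AB}\subseteq\operatorname{supp}\mathcal N(\psi^t_{AA'})$ for every $t\in\mathcal T$. -/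

import Mathlib

open Filter Topology
open scoped ComplexOrder Kronecker ENNReal

/-! Finite-dimensional quantum systems are modelled by finite index types: the system with index type
`n` has Hilbert space `ℂⁿ`, and operators on it are the matrices `Matrix n n ℂ`.
All logarithms are to base two. -/

noncomputable section

namespace QInfo

/-- Density operators: positive semidefinite with trace one. -/
structure IsState {n : Type*} [Fintype n] (ρ : Matrix n n ℂ) : Prop where
  posSemidef : ρ.PosSemidef
  trace_eq_one : ρ.trace = 1

/-- The support of a positive semidefinite matrix. For Hermitian `X` the orthogonal complement of
the kernel is the range. -/
def supp {n : Type*} [Fintype n] (X : Matrix n n ℂ) : Submodule ℂ (n → ℂ) :=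
  LinearMap.range X.mulVecLin

/-- The reduced operator on the first system (the second one is traced out). -/
def reduceFst {m n : Type*} [Fintype n] (X : Matrix (m × n) (m × n) ℂ) : Matrix m m ℂ :=
  Matrix.of fun i j => ∑ k, X (i, k) (j, k)

/-- The reduced operator on the second system (the first one is traced out). -/
def reduceSnd {m n : Type*} [Fintype m] (X : Matrix (m × n) (m × n) ℂ) : Matrix n n ℂ :=
  Matrix.of fun i j => ∑ k, X (k, i) (k, j)

/-- `(id ⊗ N)(X)`, the map `N` applied to the second tensor factor. -/
def applySnd {a m n : Type*} (N : Matrix m m ℂ →ₗ[ℂ] Matrix n n ℂ)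
    (X : Matrix (a × m) (a × m) ℂ) : Matrix (a × n) (a × n) ℂ :=
  Matrix.of fun i j => N (Matrix.of fun k l => X (i.1, k) (j.1, l)) i.2 j.2

/-- Quantum channels: completely positive and trace-preserving linear maps. -/
structure IsChannel {m n : Type*} [Fintype m] [Fintype n]
    (N : Matrix m m ℂ →ₗ[ℂ] Matrix n n ℂ) : Prop where
  completelyPositive : ∀ (k : ℕ) (X : Matrix (Fin k × m) (Fin k × m) ℂ),
    X.PosSemidef → (applySnd N X).PosSemidef
  tracePreserving : ∀ X : Matrix m m ℂ, (N X).trace = X.trace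

section Divergences

variable {n : Type*} [Fintype n] [DecidableEq n]

/-- The base-two logarithm of a Hermitian matrix, by functional calculus. Since
`Real.logb 2 0 = 0`, it is the logarithm on the support, extended by zero to the kernel. -/
def matLog (X : Matrix n n ℂ) : Matrix n n ℂ := cfc (Real.logb 2) X

/-- `2 ^ X` for a Hermitian matrix `X`, by functional calculus. -/
def matExp (X : Matrix n n ℂ) : Matrix n n ℂ := cfc (fun x : ℝ => (2 : ℝ) ^ x) X

open Classical in
/-- The quantum relative entropy `D(ρ‖σ)`. -/
def relEntropy (ρ σ : Matrix n n ℂ) : EReal :=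
  if supp ρ ≤ supp σ then (((ρ * (matLog ρ - matLog σ)).trace.re : ℝ) : EReal) else ⊤

/-- The trace of `2 ^ (α log ρ + (1 - α) log σ)`, for `ρ` and `σ` of full rank. -/
def logEuclideanTrace (α : ℝ) (ρ σ : Matrix n n ℂ) : ℝ :=
  (matExp (α • matLog ρ + (1 - α) • matLog σ)).trace.re

open Classical in
/-- The quantity in the logarithm of the log-Euclidean Rényi divergence: if `ρ` or `σ` is not of
full rank, it is the limit, possibly `∞`, of the regularised traces as `ε ↘ 0`. -/
def logEuclideanQ (α : ℝ) (ρ σ : Matrix n n ℂ) : ℝ≥0∞ :=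
  if ρ.PosDef ∧ σ.PosDef then ENNReal.ofReal (logEuclideanTrace α ρ σ)
  else limUnder (𝓝[>] (0 : ℝ)) fun ε : ℝ =>
    ENNReal.ofReal (logEuclideanTrace α (ρ + ε • (1 : Matrix n n ℂ)) (σ + ε • (1 : Matrix n n ℂ)))

/-- The base-two logarithm `[0, ∞] → [-∞, ∞]`. -/
def log2 (x : ℝ≥0∞) : EReal := ENNReal.log x / ((Real.log 2 : ℝ) : EReal)

/-- The log-Euclidean Rényi divergence of order `α`. -/
def logEuclideanDiv (α : ℝ) (ρ σ : Matrix n n ℂ) : EReal :=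
  ((1 / (α - 1) : ℝ) : EReal) * log2 (logEuclideanQ α ρ σ)

end Divergences

section Channel

variable {A A' B T : Type*} [Fintype A] [DecidableEq A] [Fintype A']
  [Fintype B] [DecidableEq B] [Fintype T]

/-- The log-Euclidean Rényi information of the channel `N` for the ensemble `{q t, ψ t}`. -/
def logEuclideanInfo (α : ℝ) (N : Matrix A' A' ℂ →ₗ[ℂ] Matrix B B ℂ) (q : T → ℝ)
    (ψ : T → Matrix (A × A') (A × A') ℂ) : EReal :=
  ∑ t, (q t : EReal) *
    ⨅ (σ : Matrix B B ℂ) (_ : IsState σ),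
      logEuclideanDiv α (applySnd N (ψ t)) (reduceFst (ψ t) ⊗ₖ σ)

/-- The supremum over `α > 1` of `((α - 1) / α) (R - I_α)`. -/
def exponentF (N : Matrix A' A' ℂ →ₗ[ℂ] Matrix B B ℂ) (R : ℝ) (q : T → ℝ)
    (ψ : T → Matrix (A × A') (A × A') ℂ) : EReal :=
  ⨆ (α : ℝ) (_ : 1 < α),
    (((α - 1) / α : ℝ) : EReal) * ((R : EReal) - logEuclideanInfo α N q ψ)

/-- The families of states `τ t` on `AB` with the support of `τ t` contained in that of
`N (ψ t)`. -/
def feasible (N : Matrix A' A' ℂ →ₗ[ℂ] Matrix B B ℂ)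
    (ψ : T → Matrix (A × A') (A × A') ℂ) : Set (T → Matrix (A × B) (A × B) ℂ) :=
  {τ | ∀ t, IsState (τ t) ∧ supp (τ t) ≤ supp (applySnd N (ψ t))}

end Channel

end QInfo

end

/-! Put `s = (α - 1) / α`, which runs through the open interval (0, 1), and write `ρ = N(ψ)` for one
member of the ensemble. By the Gibbs variational principle, the log-Euclidean trace satisfies `log Q
= max_τ (-α) (D(τ‖ρ) - s D(τ‖ρ_A ⊗ σ))` over states `τ` supported in `supp ρ`. For singular
operators this needs a limit argument (`exists_tendsto_logEuclideanTrace`), a Dini-type exchange of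
the limit with the maximum over `τ`.

For fixed `τ`, Klein's inequality makes `σ = τ_B` optimal. For fixed `σ`, the bracket is `(1 - s) tr
τ log τ` plus linear terms, hence convex in `τ`. So a minimiser `τ₀` of `D(τ‖ρ) - s D(τ‖ρ_A ⊗ τ_B)`
gives a saddle point with `σ = τ₀_B` (`exists_saddle`). The minimum over `σ` is therefore explicit,
and for fixed `α` the left-hand expression equals the minimum over families of the Lagrangian `s R +
∑ q (D(τ‖ρ) - s D(τ‖ρ_A ⊗ τ_B))` (`exists_exponent_eq_lagrangian`).

It remains to exchange the supremum over `s` with the infimum over families. Since `x_+` is the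
maximum of `s x` over `s` in [0, 1], the right-hand objective is the larger of the Lagrangians at `s
= 0` and `s = 1`. Both are convex: at `s = 1` the term `tr τ log τ` cancels and leaves `tr τ_B log
τ_B` plus linear terms. Separating two convex sets in the plane yields an optimal `s` in [0, 1]
(`exists_convex_combination_ge`), and affinity in `s` lets an interior value approximate it. -/

open Filter Topology
open scoped ComplexOrder Kronecker ENNReal

namespace QInfo

/-! ### Diagonalisation, functional calculus and supports -/

section Spectral

open Matrix

variable {n : Type*} [Fintype n] [DecidableEq n]

/-- `X = U diag(d) Uᴴ` with `U` unitary and `d` real. -/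
structure IsSpectral (U : Matrix n n ℂ) (d : n → ℝ) (X : Matrix n n ℂ) : Prop where
  conjTranspose_mul : Uᴴ * U = 1
  eq : X = U * diagonal (fun j => (d j : ℂ)) * Uᴴ

theorem IsSpectral.mul_conjTranspose {U : Matrix n n ℂ} {d : n → ℝ} {X : Matrix n n ℂ}
    (h : IsSpectral U d X) : U * Uᴴ = 1 :=
  mul_eq_one_comm.mp h.conjTranspose_mul

theorem exists_isSpectral {X : Matrix n n ℂ} (hX : X.IsHermitian) :
    ∃ U d, IsSpectral U d X := by
  refine ⟨hX.eigenvectorUnitary, hX.eigenvalues, ?_, ?_⟩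
  · exact Unitary.coe_star_mul_self hX.eigenvectorUnitary
  · conv_lhs => rw [hX.spectral_theorem]
    rfl

theorem IsSpectral.isHermitian {U : Matrix n n ℂ} {d : n → ℝ} {X : Matrix n n ℂ}
    (h : IsSpectral U d X) : X.IsHermitian := by
  rw [h.eq, IsHermitian, Matrix.conjTranspose_mul, Matrix.conjTranspose_mul,
    conjTranspose_conjTranspose,
    diagonal_conjTranspose, Matrix.mul_assoc]
  congr 2
  ext i j
  simp [diagonal_apply]

theorem IsSpectral.mul {U : Matrix n n ℂ} {d e : n → ℝ} {X Y : Matrix n n ℂ}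
    (hX : IsSpectral U d X) (hY : IsSpectral U e Y) :
    IsSpectral U (fun j => d j * e j) (X * Y) := by
  refine ⟨hX.conjTranspose_mul, ?_⟩
  rw [hX.eq, hY.eq]
  calc _ = U * diagonal (fun j => (d j : ℂ)) * (Uᴴ * U) * diagonal (fun j => (e j : ℂ)) * Uᴴ := by
        simp only [Matrix.mul_assoc]
    _ = _ := by
        rw [hX.conjTranspose_mul, Matrix.mul_one, Matrix.mul_assoc U, diagonal_mul_diagonal]
        simp

theorem IsSpectral.add {U : Matrix n n ℂ} {d e : n → ℝ} {X Y : Matrix n n ℂ}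
    (hX : IsSpectral U d X) (hY : IsSpectral U e Y) :
    IsSpectral U (fun j => d j + e j) (X + Y) := by
  refine ⟨hX.conjTranspose_mul, ?_⟩
  rw [hX.eq, hY.eq, ← Matrix.add_mul, ← Matrix.mul_add, diagonal_add]
  simp

theorem IsSpectral.smul_one {U : Matrix n n ℂ} {d : n → ℝ} {X : Matrix n n ℂ}
    (hX : IsSpectral U d X) (c : ℝ) : IsSpectral U (fun _ => c) (c • (1 : Matrix n n ℂ)) := by
  refine ⟨hX.conjTranspose_mul, ?_⟩
  have : diagonal (fun _ : n => (c : ℂ)) = c • (1 : Matrix n n ℂ) := by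
    ext i j; simp [diagonal_apply, one_apply]
  rw [this, mul_smul_comm, smul_mul_assoc, Matrix.mul_one, hX.mul_conjTranspose]

theorem IsSpectral.aeval {U : Matrix n n ℂ} {d : n → ℝ} {X : Matrix n n ℂ}
    (hX : IsSpectral U d X) (p : Polynomial ℝ) :
    IsSpectral U (fun j => p.eval (d j)) (Polynomial.aeval X p) := by
  induction p using Polynomial.induction_on with
  | C a => simpa [Algebra.algebraMap_eq_smul_one] using hX.smul_one a
  | add p q hp hq => simpa using hp.add hq
  | monomial k a h =>
    simpa [pow_succ, ← mul_assoc] using h.mul hX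

theorem IsSpectral.spectrum_subset {U : Matrix n n ℂ} {d : n → ℝ} {X : Matrix n n ℂ}
    (hX : IsSpectral U d X) : spectrum ℝ X ⊆ Set.range d := by
  intro x hx
  by_contra hcon
  refine hx ?_
  have hne : ∀ j, x - d j ≠ 0 := fun j h => hcon ⟨j, by linarith⟩
  have h1 : IsSpectral U (fun j => x - d j) (algebraMap ℝ _ x - X) := by
    have h := hX.aeval (Polynomial.C x - Polynomial.X)
    rw [map_sub, Polynomial.aeval_C, Polynomial.aeval_X] at h
    simpa only [Polynomial.eval_sub, Polynomial.eval_C, Polynomial.eval_X] using h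
  have h2 : IsSpectral U (fun j => (x - d j)⁻¹)
      (U * diagonal (fun j => (((x - d j)⁻¹ : ℝ) : ℂ)) * Uᴴ) := ⟨hX.conjTranspose_mul, rfl⟩
  have h3 := (h1.mul h2).eq
  simp only [mul_inv_cancel₀ (hne _)] at h3
  have h4 := (hX.smul_one 1).eq
  rw [one_smul] at h4
  rw [← h4] at h3
  exact IsUnit.of_mul_eq_one _ h3

/-- On the finite spectrum `f` agrees with an interpolation polynomial, so no continuity is needed
and any diagonalisation of `X` may be used. -/
theorem IsSpectral.cfc {U : Matrix n n ℂ} {d : n → ℝ} {X : Matrix n n ℂ}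
    (hX : IsSpectral U d X) (f : ℝ → ℝ) : IsSpectral U (fun j => f (d j)) (cfc f X) := by
  classical
  set p : Polynomial ℝ := Lagrange.interpolate (Finset.univ.image d) id f
  have hp : ∀ j, p.eval (d j) = f (d j) := fun j =>
    Lagrange.eval_interpolate_at_node (v := id) f (Function.injective_id.injOn)
      (Finset.mem_image_of_mem d (Finset.mem_univ j))
  have h1 : _root_.cfc f X = Polynomial.aeval X p := by
    rw [← cfc_polynomial p X hX.isHermitian]
    refine cfc_congr fun x hx => ?_
    obtain ⟨j, rfl⟩ := hX.spectrum_subset hx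
    exact (hp j).symm
  rw [h1]
  simpa only [hp] using hX.aeval p

/-- The diagonal entries of `X` in the orthonormal basis given by the columns of `U`. -/
noncomputable def weight (U X : Matrix n n ℂ) (j : n) : ℝ := ((Uᴴ * X * U) j j).re

omit [DecidableEq n] in
theorem weight_add (U X Y : Matrix n n ℂ) (j : n) :
    weight U (X + Y) j = weight U X j + weight U Y j := by
  simp [weight, Matrix.mul_add, Matrix.add_mul]

omit [DecidableEq n] in
theorem weight_smul (U X : Matrix n n ℂ) (c : ℝ) (j : n) :
    weight U (c • X) j = c * weight U X j := by
  simp [weight]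

omit [DecidableEq n] in
theorem weight_nonneg {X : Matrix n n ℂ} (hX : X.PosSemidef) (U : Matrix n n ℂ) (j : n) :
    0 ≤ weight U X j :=
  (Complex.nonneg_iff.mp (hX.conjTranspose_mul_mul_same U).diag_nonneg).1

theorem sum_weight {U : Matrix n n ℂ} (hU : U * Uᴴ = 1) (X : Matrix n n ℂ) :
    ∑ j, weight U X j = X.trace.re := by
  have : (Uᴴ * X * U).trace = X.trace := by
    rw [Matrix.trace_mul_cycle, hU, Matrix.one_mul]
  rw [← this, trace, Complex.re_sum]
  rfl

omit [DecidableEq n] in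
theorem continuous_weight (U : Matrix n n ℂ) (j : n) : Continuous fun X => weight U X j := by
  unfold weight
  fun_prop

theorem IsSpectral.trace_mul {U : Matrix n n ℂ} {d : n → ℝ} {X : Matrix n n ℂ}
    (hX : IsSpectral U d X) (Y : Matrix n n ℂ) :
    (Y * X).trace.re = ∑ j, weight U Y j * d j := by
  have : (Y * X).trace = (Uᴴ * Y * U * diagonal (fun j => (d j : ℂ))).trace := by
    conv_lhs => rw [hX.eq, ← Matrix.mul_assoc, Matrix.trace_mul_comm]
    simp only [Matrix.mul_assoc]
  rw [this, trace, Complex.re_sum]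
  refine Finset.sum_congr rfl fun j _ => ?_
  rw [diag_apply, mul_diagonal]
  simp [weight]

theorem IsSpectral.weight_self {U : Matrix n n ℂ} {d : n → ℝ} {X : Matrix n n ℂ}
    (hX : IsSpectral U d X) (j : n) : weight U X j = d j := by
  have : Uᴴ * X * U = diagonal (fun j => (d j : ℂ)) := by
    rw [hX.eq]
    calc _ = (Uᴴ * U) * diagonal (fun j => (d j : ℂ)) * (Uᴴ * U) := by
          simp only [Matrix.mul_assoc]
      _ = _ := by rw [hX.conjTranspose_mul, Matrix.one_mul, Matrix.mul_one]
  simp [weight, this]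

theorem IsSpectral.trace {U : Matrix n n ℂ} {d : n → ℝ} {X : Matrix n n ℂ}
    (hX : IsSpectral U d X) : X.trace.re = ∑ j, d j := by
  rw [← sum_weight hX.mul_conjTranspose]
  simp [hX.weight_self]

theorem IsSpectral.nonneg {U : Matrix n n ℂ} {d : n → ℝ} {X : Matrix n n ℂ}
    (hX : IsSpectral U d X) (h : X.PosSemidef) (j : n) : 0 ≤ d j :=
  hX.weight_self j ▸ weight_nonneg h U j

theorem IsSpectral.posSemidef {U : Matrix n n ℂ} {d : n → ℝ} {X : Matrix n n ℂ}
    (hX : IsSpectral U d X) (h : ∀ j, 0 ≤ d j) : X.PosSemidef := by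
  rw [hX.eq]
  refine PosSemidef.mul_mul_conjTranspose_same (PosSemidef.diagonal fun j => ?_) U
  exact Complex.zero_le_real.mpr (h j)

theorem IsSpectral.posDef {U : Matrix n n ℂ} {d : n → ℝ} {X : Matrix n n ℂ}
    (hX : IsSpectral U d X) (h : ∀ j, 0 < d j) : X.PosDef := by
  have hU : IsUnit U := IsUnit.of_mul_eq_one _ hX.mul_conjTranspose
  rw [hX.eq, ← star_eq_conjTranspose, IsUnit.posDef_star_right_conjugate_iff hU,
    posDef_diagonal_iff]
  exact fun j => by exact_mod_cast h j

theorem IsSpectral.pos {U : Matrix n n ℂ} {d : n → ℝ} {X : Matrix n n ℂ}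
    (hX : IsSpectral U d X) (h : X.PosDef) (j : n) : 0 < d j := by
  have hU : IsUnit U := IsUnit.of_mul_eq_one _ hX.mul_conjTranspose
  rw [hX.eq, ← star_eq_conjTranspose, IsUnit.posDef_star_right_conjugate_iff hU,
    posDef_diagonal_iff] at h
  exact_mod_cast h j

omit [DecidableEq n] in
theorem mulVec_col_eq_zero {Y : Matrix n n ℂ} (hY : Y.PosSemidef) {U : Matrix n n ℂ} {j : n}
    (h : weight U Y j = 0) : Y *ᵥ (U.col j) = 0 := by
  rw [← hY.dotProduct_mulVec_zero_iff]
  have h1 : star (U.col j) ⬝ᵥ Y *ᵥ U.col j = (Uᴴ * Y * U) j j := by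
    rw [Matrix.mul_assoc, Matrix.mul_apply]
    simp only [dotProduct, mulVec, Matrix.mul_apply, conjTranspose_apply, Pi.star_apply, col_apply]
  rw [h1]
  have h2 := Complex.nonneg_iff.mp ((hY.conjTranspose_mul_mul_same U).diag_nonneg (i := j))
  exact Complex.ext h h2.2.symm

/-- Kernel eigenvectors of `X` are orthogonal to its range. Conversely, a positive semidefinite `Y`
with zero weight on them annihilates them, so it factors through the range projector. This turns
every support condition into vanishing of finitely many weights. -/
theorem IsSpectral.supp_le_iff {U : Matrix n n ℂ} {d : n → ℝ} {X Y : Matrix n n ℂ}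
    (hX : IsSpectral U d X) (hY : Y.PosSemidef) :
    supp Y ≤ supp X ↔ ∀ j, d j = 0 → weight U Y j = 0 := by
  constructor
  · intro h j hj
    have h1 : Y *ᵥ U.col j ∈ supp X := h ⟨_, rfl⟩
    obtain ⟨y, hy⟩ := h1
    rw [mulVecLin_apply] at hy
    have h2 : (Uᴴ * Y * U) j j = (Uᴴ *ᵥ (Y *ᵥ U.col j)) j := by
      rw [Matrix.mul_assoc, Matrix.mul_apply]
      simp only [mulVec, dotProduct, Matrix.mul_apply, col_apply]
    rw [weight, h2, ← hy, mulVec_mulVec, hX.eq, ← Matrix.mul_assoc, ← Matrix.mul_assoc,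
      hX.conjTranspose_mul, Matrix.one_mul, ← mulVec_mulVec, mulVec_diagonal, hj]
    simp
  · intro h
    have hYU : Y * U = Y * U * diagonal (fun j => if d j = 0 then (0 : ℂ) else 1) := by
      ext i j
      rw [mul_diagonal]
      split_ifs with hj
      · have := congrFun (mulVec_col_eq_zero hY (h j hj)) i
        rw [mul_zero]
        simpa [mulVec, dotProduct, Matrix.mul_apply] using this
      · rw [mul_one]
    have hY' : Y = Y * (U * diagonal (fun j => if d j = 0 then (0 : ℂ) else 1) * Uᴴ) := by
      calc Y = Y * (U * Uᴴ) := by rw [hX.mul_conjTranspose, Matrix.mul_one]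
        _ = (Y * U) * Uᴴ := by rw [Matrix.mul_assoc]
        _ = (Y * U * diagonal (fun j => if d j = 0 then (0 : ℂ) else 1)) * Uᴴ := by rw [← hYU]
        _ = _ := by simp only [Matrix.mul_assoc]
    have hP : IsSpectral U (fun j => if d j = 0 then (0 : ℝ) else 1)
        (U * diagonal (fun j => if d j = 0 then (0 : ℂ) else 1) * Uᴴ) := by
      refine ⟨hX.conjTranspose_mul, ?_⟩
      congr 3
      ext j
      split_ifs <;> simp
    -- As `0⁻¹ = 0`, this is the pseudo-inverse of `X`; its product with `X` is the range projector.
    have hR : IsSpectral U (fun j => (d j)⁻¹)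
        (U * diagonal (fun j => (((d j)⁻¹ : ℝ) : ℂ)) * Uᴴ) := ⟨hX.conjTranspose_mul, rfl⟩
    have hfun : (fun j => d j * (d j)⁻¹) = fun j => if d j = 0 then (0 : ℝ) else 1 := by
      ext j
      split_ifs with hj
      · simp [hj]
      · exact mul_inv_cancel₀ hj
    have hXR := (hX.mul hR).eq
    simp only [congrFun hfun] at hXR
    rw [← hP.eq] at hXR
    have hY2 : Y = X * (U * diagonal (fun j => (((d j)⁻¹ : ℝ) : ℂ)) * Uᴴ * Y) := by
      rw [← Matrix.mul_assoc, hXR]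
      conv_lhs => rw [← hY.1.eq, hY', Matrix.conjTranspose_mul, hP.isHermitian.eq, hY.1.eq]
    rintro _ ⟨v, rfl⟩
    rw [mulVecLin_apply, hY2, ← mulVec_mulVec]
    exact ⟨_, rfl⟩

theorem supp_le_of_posDef {X : Matrix n n ℂ} (hX : X.PosDef) {Y : Matrix n n ℂ}
    (hY : Y.PosSemidef) : supp Y ≤ supp X := by
  obtain ⟨U, d, hd⟩ := exists_isSpectral hX.1
  rw [hd.supp_le_iff hY]
  exact fun j hj => absurd hj (hd.pos hX j).ne'

end Spectral

/-! ### Klein's inequality -/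

section Entropy

open Matrix

variable {n : Type*} [Fintype n] [DecidableEq n]

/-- The real number `tr X log Y`. -/
noncomputable def traceLog (X Y : Matrix n n ℂ) : ℝ := (X * matLog Y).trace.re

theorem IsSpectral.traceLog {U : Matrix n n ℂ} {d : n → ℝ} {X : Matrix n n ℂ}
    (hX : IsSpectral U d X) (Y : Matrix n n ℂ) :
    traceLog Y X = ∑ j, weight U Y j * Real.logb 2 (d j) :=
  (hX.cfc (Real.logb 2)).trace_mul Y

theorem traceLog_add_smul (a b : ℝ) (X Y Z : Matrix n n ℂ) :
    traceLog (a • X + b • Y) Z = a * traceLog X Z + b * traceLog Y Z := by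
  simp [traceLog, Matrix.add_mul]

theorem continuous_traceLog (Y : Matrix n n ℂ) : Continuous fun X => traceLog X Y := by
  unfold traceLog
  fun_prop

theorem mul_logb_sub_mul_logb_ge {x y : ℝ} (hx : 0 ≤ x) (hy : 0 < y) :
    (x - y) / Real.log 2 ≤ x * Real.logb 2 x - x * Real.logb 2 y := by
  have h2 : 0 < Real.log 2 := Real.log_pos one_lt_two
  rcases hx.eq_or_lt with rfl | hx
  · simp only [zero_sub, zero_mul, sub_zero]
    exact div_nonpos_of_nonpos_of_nonneg (by linarith) h2.le
  · have h := Real.one_sub_inv_le_log_of_pos (div_pos hx hy)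
    rw [Real.log_div hx.ne' hy.ne', inv_div] at h
    have h3 : x - y ≤ x * (Real.log x - Real.log y) := by
      calc x - y = x * (1 - y / x) := by field_simp
        _ ≤ _ := by gcongr
    rw [← mul_sub, Real.logb, Real.logb, ← sub_div, ← mul_div_assoc]
    gcongr

/-- Klein's inequality. -/
theorem traceLog_le {X Y : Matrix n n ℂ} (hX : X.PosSemidef) (hY : Y.PosSemidef)
    (h : supp X ≤ supp Y) :
    (X.trace.re - Y.trace.re) / Real.log 2 ≤ traceLog X X - traceLog X Y := by
  obtain ⟨V, p, hp⟩ := exists_isSpectral hX.1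
  obtain ⟨U, d, hd⟩ := exists_isSpectral hY.1
  rw [hd.supp_le_iff hX] at h
  -- The squared overlaps of the two eigenbases form a doubly stochastic matrix, which reduces the
  -- claim to the scalar inequality for each pair of eigenvalues.
  set c : n → n → ℝ := fun i j => ‖(Vᴴ * U) i j‖ ^ 2 with hc
  have hw : ∀ j, weight U X j = ∑ i, c i j * p i := by
    intro j
    have : Uᴴ * X * U = (Vᴴ * U)ᴴ * diagonal (fun i => (p i : ℂ)) * (Vᴴ * U) := by
      rw [hp.eq, conjTranspose_mul, conjTranspose_conjTranspose]
      simp only [Matrix.mul_assoc]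
    rw [weight, this, Matrix.mul_apply, Complex.re_sum]
    refine Finset.sum_congr rfl fun i _ => ?_
    rw [mul_diagonal, conjTranspose_apply, hc]
    have : star ((Vᴴ * U) i j) * (p i : ℂ) * (Vᴴ * U) i j
        = ((‖(Vᴴ * U) i j‖ ^ 2 * p i : ℝ) : ℂ) := by
      push_cast
      rw [← Complex.conj_mul']
      simp only [Complex.star_def]
      ring
    rw [this, Complex.ofReal_re]
  have hone : ∀ W : Matrix n n ℂ, Wᴴ * W = 1 → ∀ j, ∑ i, ‖W i j‖ ^ 2 = 1 := by
    intro W hW j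
    have h1 := congrFun (congrFun hW j) j
    rw [Matrix.mul_apply, one_apply_eq] at h1
    have h2 : (((∑ i, ‖W i j‖ ^ 2 : ℝ)) : ℂ) = 1 := by
      rw [← h1]
      push_cast
      refine Finset.sum_congr rfl fun i _ => ?_
      rw [← Complex.conj_mul', conjTranspose_apply]
      rfl
    exact_mod_cast h2
  have hW : (Vᴴ * U)ᴴ * (Vᴴ * U) = 1 := by
    rw [conjTranspose_mul, conjTranspose_conjTranspose, Matrix.mul_assoc, ← Matrix.mul_assoc V,
      hp.mul_conjTranspose, Matrix.one_mul, hd.conjTranspose_mul]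
  have hcol : ∀ j, ∑ i, c i j = 1 := hone _ hW
  have hrow : ∀ i, ∑ j, c i j = 1 := by
    intro i
    have := hone (Vᴴ * U)ᴴ (by rw [conjTranspose_conjTranspose]; exact mul_eq_one_comm.mp hW) i
    simpa [hc, conjTranspose_apply] using this
  have e1 : traceLog X X = ∑ j, ∑ i, c i j * (p i * Real.logb 2 (p i)) := by
    rw [hp.traceLog, Finset.sum_comm]
    simp only [hp.weight_self, ← Finset.sum_mul, hrow, one_mul]
  have e2 : traceLog X Y = ∑ j, ∑ i, c i j * (p i * Real.logb 2 (d j)) := by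
    rw [hd.traceLog]
    refine Finset.sum_congr rfl fun j _ => ?_
    rw [hw, Finset.sum_mul]
    exact Finset.sum_congr rfl fun i _ => by ring
  have e3 : (X.trace.re - Y.trace.re) / Real.log 2
      = ∑ j, ∑ i, c i j * ((p i - d j) / Real.log 2) := by
    simp only [mul_div_assoc', ← Finset.sum_div, mul_sub, Finset.sum_sub_distrib]
    congr 2
    · rw [hp.trace, Finset.sum_comm]
      simp only [← Finset.sum_mul, hrow, one_mul]
    · rw [hd.trace]
      simp only [← Finset.sum_mul, hcol, one_mul]
  rw [e1, e2, e3, ← Finset.sum_sub_distrib]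
  refine Finset.sum_le_sum fun j _ => ?_
  rw [← Finset.sum_sub_distrib]
  refine Finset.sum_le_sum fun i _ => ?_
  rw [← mul_sub]
  have hc0 : ∀ i, 0 ≤ c i j := fun i => by positivity
  -- At a zero eigenvalue of `Y` the scalar inequality is unavailable; there the support hypothesis
  -- forces each `c i j * p i` to vanish.
  rcases (hd.nonneg hY j).eq_or_lt with hj | hj
  · have h0 := h j hj.symm
    rw [hw, Finset.sum_eq_zero_iff_of_nonneg
      fun i _ => mul_nonneg (hc0 i) (hp.nonneg hX i)] at h0
    rcases mul_eq_zero.mp (h0 i (Finset.mem_univ i)) with h1 | h1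
    · simp [h1]
    · simp [h1, ← hj]
  · exact mul_le_mul_of_nonneg_left (mul_logb_sub_mul_logb_ge (hp.nonneg hX i) hj) (hc0 i)

theorem IsState.traceLog_le {X Y : Matrix n n ℂ} (hX : IsState X) (hY : IsState Y)
    (h : supp X ≤ supp Y) : traceLog X Y ≤ traceLog X X := by
  have := QInfo.traceLog_le hX.1 hY.1 h
  rw [hX.2, hY.2] at this
  simpa using this

end Entropy

end QInfo

namespace QInfo

/-! ### Convexity, continuity and compactness on the set of states -/

section States

open Matrix

variable {n : Type*} [Fintype n]

theorem IsState.nonempty {X : Matrix n n ℂ} (hX : IsState X) : Nonempty n := by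
  by_contra h
  rw [not_nonempty_iff] at h
  have := hX.2
  simp [Matrix.trace] at this

theorem IsState.mix {X Y : Matrix n n ℂ} (hX : IsState X) (hY : IsState Y) {a b : ℝ}
    (ha : 0 ≤ a) (hb : 0 ≤ b) (hab : a + b = 1) : IsState (a • X + b • Y) := by
  refine ⟨(hX.1.smul ha).add (hY.1.smul hb), ?_⟩
  rw [trace_add, trace_smul, trace_smul, hX.2, hY.2, ← add_smul, hab, one_smul]

variable [DecidableEq n]

theorem posDef_add_smul_one {X : Matrix n n ℂ} (hX : X.PosSemidef) {ε : ℝ} (hε : 0 < ε) :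
    (X + ε • (1 : Matrix n n ℂ)).PosDef := by
  obtain ⟨U, d, hd⟩ := exists_isSpectral hX.1
  exact (hd.add (hd.smul_one ε)).posDef fun j => by linarith [hd.nonneg hX j]

theorem IsState.one_sub_posSemidef {X : Matrix n n ℂ} (hX : IsState X) :
    (1 - X).PosSemidef := by
  obtain ⟨U, d, hd⟩ := exists_isSpectral hX.1.1
  have h1 : IsSpectral U (fun j => 1 - d j) (1 - X) := by
    have h := hd.aeval (1 - Polynomial.X)
    rw [map_sub, map_one, Polynomial.aeval_X] at h
    simpa only [Polynomial.eval_sub, Polynomial.eval_one, Polynomial.eval_X] using h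
  refine h1.posSemidef fun j => ?_
  have h2 := hd.trace
  rw [hX.2, Complex.one_re] at h2
  have := Finset.single_le_sum (f := d) (fun i _ => hd.nonneg hX.1 i) (Finset.mem_univ j)
  linarith

theorem supp_le_mix_left {X Y : Matrix n n ℂ} (hX : X.PosSemidef) (hY : Y.PosSemidef) {a b : ℝ}
    (ha : 0 < a) (hb : 0 ≤ b) : supp X ≤ supp (a • X + b • Y) := by
  have hXY : (a • X + b • Y).PosSemidef := (hX.smul ha.le).add (hY.smul hb)
  obtain ⟨U, d, hd⟩ := exists_isSpectral hXY.1
  rw [hd.supp_le_iff hX]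
  intro j hj
  have h := hd.weight_self j
  rw [weight_add, weight_smul, weight_smul, hj] at h
  have h1 := weight_nonneg hX U j
  have h2 := weight_nonneg hY U j
  have h3 : 0 ≤ b * weight U Y j := by positivity
  have h4 : a * weight U X j ≤ 0 := by linarith
  exact le_antisymm (by_contra fun h5 => by nlinarith) h1

theorem supp_le_mix_right {X Y : Matrix n n ℂ} (hX : X.PosSemidef) (hY : Y.PosSemidef) {a b : ℝ}
    (ha : 0 ≤ a) (hb : 0 < b) : supp Y ≤ supp (a • X + b • Y) :=
  add_comm (a • X) (b • Y) ▸ supp_le_mix_left hY hX hb ha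

omit [DecidableEq n] in
theorem supp_mix_le {X Y Z : Matrix n n ℂ} {a b : ℝ} (hX : supp X ≤ supp Z)
    (hY : supp Y ≤ supp Z) : supp (a • X + b • Y) ≤ supp Z := by
  rintro _ ⟨v, rfl⟩
  have h1 : (a • X + b • Y).mulVecLin v = (a : ℂ) • X.mulVecLin v + (b : ℂ) • Y.mulVecLin v := by
    simp only [mulVecLin_apply, add_mulVec, smul_mulVec]
    rfl
  rw [h1]
  exact Submodule.add_mem _ (Submodule.smul_mem _ _ (hX ⟨v, rfl⟩))
    (Submodule.smul_mem _ _ (hY ⟨v, rfl⟩))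

/-- The states supported in the support of `ρ`. -/
def supportedStates (ρ : Matrix n n ℂ) : Set (Matrix n n ℂ) :=
  {τ | IsState τ ∧ supp τ ≤ supp ρ}

omit [DecidableEq n] in
theorem convex_supportedStates (ρ : Matrix n n ℂ) : Convex ℝ (supportedStates ρ) :=
  fun _ hX _ hY _ _ ha hb hab => ⟨hX.1.mix hY.1 ha hb hab, supp_mix_le hX.2 hY.2⟩

/-- Convexity of the negative entropy. -/
theorem convexOn_traceLog_self : ConvexOn ℝ {X : Matrix n n ℂ | IsState X}
    fun X => traceLog X X := by
  rw [convexOn_iff_forall_pos]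
  refine ⟨fun _ hX _ hY _ _ ha hb hab => hX.mix hY ha hb hab,
    fun X hX Y hY a b ha hb hab => ?_⟩
  have hZ := hX.mix hY ha.le hb.le hab
  -- Linearity in the first argument only: the logarithm of the mixture stays, and Klein's
  -- inequality replaces it by `log X` and `log Y` separately.
  rw [traceLog_add_smul, smul_eq_mul, smul_eq_mul]
  gcongr
  · exact hX.traceLog_le hZ (supp_le_mix_left hX.1 hY.1 ha hb.le)
  · exact hY.traceLog_le hZ (supp_le_mix_right hX.1 hY.1 ha.le hb)

section Compactness

open scoped MatrixOrder Matrix.Norms.L2Operator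

theorem isClosed_setOf_posSemidef : IsClosed {X : Matrix n n ℂ | X.PosSemidef} := by
  simp_rw [← nonneg_iff_posSemidef]
  exact isClosed_Ici

theorem isCompact_setOf_isState : IsCompact {X : Matrix n n ℂ | IsState X} := by
  have hclosed : IsClosed {X : Matrix n n ℂ | IsState X} := by
    have h1 : {X : Matrix n n ℂ | IsState X} = {X | X.PosSemidef} ∩ {X | X.trace = 1} :=
      Set.ext fun X => ⟨fun h => ⟨h.1, h.2⟩, fun h => ⟨h.1, h.2⟩⟩
    rw [h1]
    exact isClosed_setOf_posSemidef.inter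
      (isClosed_singleton.preimage (Continuous.matrix_trace continuous_id))
  refine Metric.isCompact_of_isClosed_isBounded hclosed
    ((Metric.isBounded_closedBall (x := (0 : Matrix n n ℂ)) (r := 1)).subset fun X hX => ?_)
  rw [mem_closedBall_zero_iff,
    CStarAlgebra.norm_le_one_iff_of_nonneg X (nonneg_iff_posSemidef.mpr hX.1)]
  exact hX.one_sub_posSemidef

/-- Unlike the logarithm, `x log x` is continuous at zero, so this form gives continuity of the
entropy up to singular states. -/
theorem traceLog_self_eq {X : Matrix n n ℂ} (hX : X.PosSemidef) :
    traceLog X X = (cfc (fun x : ℝ => x * Real.log x / Real.log 2) X).trace.re := by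
  obtain ⟨U, d, hd⟩ := exists_isSpectral hX.1
  rw [hd.traceLog, (hd.cfc _).trace]
  exact Finset.sum_congr rfl fun j _ => by rw [hd.weight_self, Real.logb, mul_div_assoc]

theorem continuousOn_traceLog_self :
    ContinuousOn (fun X : Matrix n n ℂ => traceLog X X) {X | IsState X} := by
  have h : ContinuousOn (fun X : Matrix n n ℂ =>
      cfc (fun x : ℝ => x * Real.log x / Real.log 2) X) {X | IsState X} := by
    refine ContinuousOn.cfc' (isCompact_Icc (a := (0 : ℝ)) (b := 1)) _ continuousOn_id ?_
      (fun X hX => hX.1.1) (Real.continuous_mul_log.div_const _).continuousOn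
    intro X hX x hx
    obtain ⟨U, d, hd⟩ := exists_isSpectral hX.1.1
    obtain ⟨j, rfl⟩ := hd.spectrum_subset hx
    refine ⟨hd.nonneg hX.1 j, ?_⟩
    have h2 := hd.trace
    rw [hX.2, Complex.one_re] at h2
    rw [h2]
    exact Finset.single_le_sum (f := d) (fun i _ => hd.nonneg hX.1 i) (Finset.mem_univ j)
  refine ContinuousOn.congr ?_ fun X hX => traceLog_self_eq hX.1
  exact Complex.continuous_re.comp_continuousOn
    ((Continuous.matrix_trace continuous_id).comp_continuousOn h)

/-- Operator monotonicity of the logarithm, tested against `Y`. -/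
theorem traceLog_mono {X X' Y : Matrix n n ℂ} (hX : X.PosDef) (hXX' : (X' - X).PosSemidef)
    (hY : Y.PosSemidef) : traceLog Y X ≤ traceLog Y X' := by
  have hX' : X'.PosDef := by simpa using hX.add_posSemidef hXX'
  have hlog : ∀ Z : Matrix n n ℂ, Z.PosDef → matLog Z = (Real.log 2)⁻¹ • CFC.log Z := by
    intro Z hZ
    obtain ⟨U, d, hd⟩ := exists_isSpectral hZ.1
    have h1 := (hd.cfc Real.log)
    have h2 := ((hd.smul_one (Real.log 2)⁻¹).mul h1).eq
    rw [smul_one_mul] at h2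
    rw [CFC.log, h2, matLog, (hd.cfc (Real.logb 2)).eq]
    simp only [Real.logb, div_eq_inv_mul]
  have h := CFC.log_le_log (a := X) (b := X') hXX' (isStrictlyPositive_iff_posDef.mpr hX)
  rw [le_iff] at h
  obtain ⟨V, e, he⟩ := exists_isSpectral h.1
  have h3 : 0 ≤ (Y * (CFC.log X' - CFC.log X)).trace.re := by
    rw [he.trace_mul]
    exact Finset.sum_nonneg fun j _ => mul_nonneg (weight_nonneg hY V j) (he.nonneg h j)
  have h4 : traceLog Y X' - traceLog Y X
      = (Real.log 2)⁻¹ * (Y * (CFC.log X' - CFC.log X)).trace.re := by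
    rw [traceLog, traceLog, hlog X hX, hlog X' hX', ← Complex.sub_re, ← trace_sub,
      ← Matrix.mul_sub, ← smul_sub, mul_smul_comm, trace_smul, Complex.smul_re, smul_eq_mul]
  have h5 : 0 < Real.log 2 := Real.log_pos one_lt_two
  have : 0 ≤ traceLog Y X' - traceLog Y X := by rw [h4]; positivity
  linarith

end Compactness

/-- Among states, the support condition amounts to finitely many closed conditions on weights. -/
theorem isCompact_supportedStates {ρ : Matrix n n ℂ} (hρ : ρ.IsHermitian) :
    IsCompact (supportedStates ρ) := by
  obtain ⟨U, d, hd⟩ := exists_isSpectral hρ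
  have h : supportedStates ρ
      = {τ | IsState τ} ∩ ⋂ j, ⋂ (_ : d j = 0), {τ | weight U τ j = 0} := by
    ext τ
    simp only [supportedStates, Set.mem_ofPred_eq, Set.mem_inter_iff, Set.mem_iInter]
    exact and_congr_right fun h => hd.supp_le_iff h.1
  rw [h]
  exact isCompact_setOf_isState.inter_right <| isClosed_iInter fun j => isClosed_iInter fun _ =>
    isClosed_singleton.preimage (continuous_weight U j)

end States

/-! ### Logarithms of `X + ε` as `ε ↘ 0` -/

section Regularisation

open Matrix

/-- One positively weighted term diverges, while all others stay below their values at `ε = 1`. -/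
theorem tendsto_sum_mul_atBot {ι : Type*} [Fintype ι] {w d : ι → ℝ} (hw : ∀ j, 0 ≤ w j)
    (hd : ∀ j, 0 ≤ d j) {φ : ℝ → ℝ → ℝ}
    (hφ : ∀ ε, 0 < ε → ε ≤ 1 → ∀ x, 0 ≤ x → φ ε x ≤ φ 1 x)
    (hφ0 : Tendsto (fun ε => φ ε 0) (𝓝[>] 0) atBot) {j : ι} (hj : d j = 0) (hwj : w j ≠ 0) :
    Tendsto (fun ε => ∑ i, w i * φ ε (d i)) (𝓝[>] 0) atBot := by
  classical
  have h1 : Tendsto (fun ε => w j * φ ε 0 + ∑ i ∈ Finset.univ.erase j, w i * φ 1 (d i))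
      (𝓝[>] 0) atBot :=
    tendsto_atBot_add_const_right _ _
      (hφ0.const_mul_atBot (lt_of_le_of_ne (hw j) (Ne.symm hwj)))
  refine tendsto_atBot_mono' _ ?_ h1
  filter_upwards [Ioc_mem_nhdsGT (zero_lt_one' ℝ)] with ε hε
  rw [← Finset.add_sum_erase _ _ (Finset.mem_univ j), hj]
  gcongr with i
  · exact hw i
  · exact hφ ε hε.1 hε.2 _ (hd i)

theorem tendsto_logb_two_nhdsGT_zero : Tendsto (Real.logb 2) (𝓝[>] 0) atBot := by
  have h := Real.tendsto_log_nhdsGT_zero.const_mul_atBot (inv_pos.mpr (Real.log_pos one_lt_two))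
  refine h.congr fun x => ?_
  rw [Real.logb, div_eq_inv_mul]

variable {n : Type*} [Fintype n] [DecidableEq n]

theorem tendsto_traceLog_add_smul_one {X Y : Matrix n n ℂ} (hX : X.PosSemidef)
    (hY : Y.PosSemidef) (h : supp Y ≤ supp X) :
    Tendsto (fun ε : ℝ => traceLog Y (X + ε • (1 : Matrix n n ℂ))) (𝓝[>] 0)
      (𝓝 (traceLog Y X)) := by
  obtain ⟨U, d, hd⟩ := exists_isSpectral hX.1
  rw [hd.supp_le_iff hY] at h
  simp only [hd.traceLog, (hd.add (hd.smul_one _)).traceLog]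
  refine tendsto_finsetSum _ fun j _ => ?_
  by_cases hj : d j = 0
  · simp [h j hj]
  · refine Tendsto.const_mul _ (Tendsto.mono_left ?_ nhdsWithin_le_nhds)
    have h1 : ContinuousAt (fun ε : ℝ => Real.logb 2 (d j + ε)) 0 := by
      have : d j + 0 ≠ 0 := by simpa using hj
      unfold Real.logb
      fun_prop (disch := assumption)
    simpa [ContinuousAt] using h1

theorem tendsto_traceLog_add_smul_one_atBot {X Y : Matrix n n ℂ} (hX : X.PosSemidef)
    (hY : Y.PosSemidef) (h : ¬ supp Y ≤ supp X) :
    Tendsto (fun ε : ℝ => traceLog Y (X + ε • (1 : Matrix n n ℂ))) (𝓝[>] 0) atBot := by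
  obtain ⟨U, d, hd⟩ := exists_isSpectral hX.1
  rw [hd.supp_le_iff hY] at h
  push Not at h
  obtain ⟨j, hj, hwj⟩ := h
  simp only [(hd.add (hd.smul_one _)).traceLog]
  refine tendsto_sum_mul_atBot (φ := fun ε x => Real.logb 2 (x + ε)) (weight_nonneg hY U)
    (hd.nonneg hX) (fun ε hε hε1 x hx => ?_) (by simpa using tendsto_logb_two_nhdsGT_zero) hj hwj
  exact Real.logb_le_logb_of_le one_lt_two (by linarith) (by linarith)

theorem traceLog_le_add_smul_one {X Y : Matrix n n ℂ} (hX : X.PosSemidef)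
    (hY : Y.PosSemidef) (h : supp Y ≤ supp X) {ε : ℝ} (hε : 0 ≤ ε) :
    traceLog Y X ≤ traceLog Y (X + ε • (1 : Matrix n n ℂ)) := by
  obtain ⟨U, d, hd⟩ := exists_isSpectral hX.1
  rw [hd.supp_le_iff hY] at h
  rw [hd.traceLog, (hd.add (hd.smul_one ε)).traceLog]
  refine Finset.sum_le_sum fun j _ => ?_
  rcases (hd.nonneg hX j).eq_or_lt with hj | hj
  · simp [h j hj.symm]
  · exact mul_le_mul_of_nonneg_left (Real.logb_le_logb_of_le one_lt_two hj (by linarith))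
      (weight_nonneg hY U j)

/-- Upper semicontinuity of `X ↦ tr Y log X` along the segment from `X` to `Y`. -/
theorem IsState.le_traceLog_of_mix {X Y : Matrix n n ℂ} (hX : IsState X) (hY : IsState Y) {c : ℝ}
    (h : ∀ l : ℝ, 0 < l → l < 1 → c ≤ traceLog Y ((1 - l) • X + l • Y)) :
    supp Y ≤ supp X ∧ c ≤ traceLog Y X := by
  -- The eigenbasis of the mixture moves with `l`. Operator monotonicity replaces the mixture by the
  -- larger `X + 2l`, whose eigenbasis is fixed; the difference is positive because `Y ≤ 1`.
  have key : ∀ l : ℝ, 0 < l → l < 1 →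
      c ≤ traceLog Y (X + (2 * l) • (1 : Matrix n n ℂ)) := by
    intro l hl hl1
    have hZ := hX.mix hY (by linarith : 0 ≤ 1 - l) hl.le (by ring)
    refine (h l hl hl1).trans ((traceLog_le_add_smul_one hZ.1 hY.1
      (supp_le_mix_right hX.1 hY.1 (by linarith) hl) hl.le).trans
      (traceLog_mono (posDef_add_smul_one hZ.1 hl) ?_ hY.1))
    have : X + (2 * l) • (1 : Matrix n n ℂ) - ((1 - l) • X + l • Y + l • (1 : Matrix n n ℂ))
        = l • X + l • (1 - Y) := by
      module
    rw [this]
    exact (hX.1.smul hl.le).add (hY.one_sub_posSemidef.smul hl.le)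
  have hlim : Tendsto (fun l : ℝ => 2 * l) (𝓝[>] 0) (𝓝[>] 0) := by
    refine tendsto_nhdsWithin_of_tendsto_nhds_of_eventually_within _ ?_ ?_
    · have : Tendsto (fun l : ℝ => 2 * l) (𝓝 0) (𝓝 (2 * 0)) := tendsto_id.const_mul 2
      rw [mul_zero] at this
      exact this.mono_left nhdsWithin_le_nhds
    · filter_upwards [self_mem_nhdsWithin] with l hl
      exact mul_pos two_pos (Set.mem_Ioi.mp hl)
  have hev : ∀ᶠ l : ℝ in 𝓝[>] 0, c ≤ traceLog Y (X + (2 * l) • (1 : Matrix n n ℂ)) := by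
    filter_upwards [Ioo_mem_nhdsGT (zero_lt_one' ℝ)] with l hl
    exact key l hl.1 hl.2
  have hsupp : supp Y ≤ supp X := by
    by_contra hcon
    have h1 := (tendsto_traceLog_add_smul_one_atBot hX.1 hY.1 hcon).comp hlim
    obtain ⟨l, hl1, hl2⟩ := (hev.and (h1.eventually_lt_atBot c)).exists
    exact absurd hl1 (not_le.mpr hl2)
  exact ⟨hsupp, ge_of_tendsto ((tendsto_traceLog_add_smul_one hX.1 hY.1 hsupp).comp hlim) hev⟩

end Regularisation

end QInfo

namespace QInfo

/-! ### Gibbs variational principle -/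

section Gibbs

open Matrix

variable {n : Type*} [Fintype n] [DecidableEq n]

theorem isHermitian_matLog (X : Matrix n n ℂ) : (matLog X).IsHermitian :=
  cfc_predicate (Real.logb 2) X

theorem IsSpectral.trace_matExp {U : Matrix n n ℂ} {h : n → ℝ} {H : Matrix n n ℂ}
    (hH : IsSpectral U h H) : (matExp H).trace.re = ∑ j, (2 : ℝ) ^ h j :=
  (hH.cfc _).trace

theorem trace_matExp_pos [Nonempty n] {H : Matrix n n ℂ} (hH : H.IsHermitian) :
    0 < (matExp H).trace.re := by
  obtain ⟨U, h, hh⟩ := exists_isSpectral hH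
  rw [hh.trace_matExp]
  exact Finset.sum_pos (fun j _ => by positivity) Finset.univ_nonempty

/-- The Gibbs state `2 ^ H / tr 2 ^ H`. -/
theorem exists_gibbs_state [Nonempty n] {H : Matrix n n ℂ} (hH : H.IsHermitian) :
    ∃ σ : Matrix n n ℂ, σ.PosDef ∧ IsState σ ∧ ∀ τ, IsState τ →
      traceLog τ σ = (τ * H).trace.re - Real.logb 2 (matExp H).trace.re := by
  obtain ⟨U, h, hh⟩ := exists_isSpectral hH
  have hZ := trace_matExp_pos hH
  set Z := (matExp H).trace.re with hZdef
  have hσ := hh.cfc (fun x : ℝ => (2 : ℝ) ^ x / Z)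
  have hpos := hσ.posDef fun j => by positivity
  refine ⟨_, hpos, ⟨hpos.posSemidef, ?_⟩, fun τ hτ => ?_⟩
  · refine Complex.ext ?_ (Complex.nonneg_iff.mp hpos.posSemidef.trace_nonneg).2.symm
    rw [hσ.trace, ← Finset.sum_div, ← hh.trace_matExp, Complex.one_re]
    exact div_self hZ.ne'
  · rw [hσ.traceLog, hh.trace_mul]
    have h1 := sum_weight hh.mul_conjTranspose τ
    rw [hτ.2, Complex.one_re] at h1
    have h2 : ∀ j, Real.logb 2 ((2 : ℝ) ^ h j / Z) = h j - Real.logb 2 Z := fun j => by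
      rw [Real.logb_div (by positivity) hZ.ne', Real.logb_rpow two_pos (by norm_num)]
    simp only [h2, mul_sub, Finset.sum_sub_distrib, ← Finset.sum_mul, h1, one_mul]

/-- The objective function in the Gibbs variational formula for `logEuclideanTrace`. -/
noncomputable def gibbsObjective (α : ℝ) (ρ σ τ : Matrix n n ℂ) : ℝ :=
  α * traceLog τ ρ + (1 - α) * traceLog τ σ - traceLog τ τ

theorem isHermitian_logEuclidean (α : ℝ) (ρ σ : Matrix n n ℂ) :
    (α • matLog ρ + (1 - α) • matLog σ).IsHermitian :=
  ((isHermitian_matLog ρ).smul (IsSelfAdjoint.all α)).add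
    ((isHermitian_matLog σ).smul (IsSelfAdjoint.all (1 - α)))

theorem trace_mul_logEuclidean (α : ℝ) (ρ σ τ : Matrix n n ℂ) :
    (τ * (α • matLog ρ + (1 - α) • matLog σ)).trace.re
      = α * traceLog τ ρ + (1 - α) * traceLog τ σ := by
  simp [traceLog, Matrix.mul_add]

/-- This is nonnegativity of the relative entropy of `τ` with respect to the Gibbs state of `α log ρ
+ (1 - α) log σ`. -/
theorem gibbsObjective_le (α : ℝ) (ρ σ : Matrix n n ℂ) {τ : Matrix n n ℂ} (hτ : IsState τ) :
    gibbsObjective α ρ σ τ ≤ Real.logb 2 (logEuclideanTrace α ρ σ) := by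
  have := hτ.nonempty
  obtain ⟨ω, hω, hω', h⟩ := exists_gibbs_state (isHermitian_logEuclidean α ρ σ)
  have h1 := h τ hτ
  rw [trace_mul_logEuclidean] at h1
  have h2 := hτ.traceLog_le hω' (supp_le_of_posDef hω hτ.1)
  rw [gibbsObjective, logEuclideanTrace]
  linarith

theorem exists_gibbsObjective_eq [Nonempty n] (α : ℝ) (ρ σ : Matrix n n ℂ) :
    ∃ τ, IsState τ ∧ gibbsObjective α ρ σ τ = Real.logb 2 (logEuclideanTrace α ρ σ) := by
  obtain ⟨ω, hω, hω', h⟩ := exists_gibbs_state (isHermitian_logEuclidean α ρ σ)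
  refine ⟨ω, hω', ?_⟩
  have h1 := h ω hω'
  rw [trace_mul_logEuclidean] at h1
  rw [gibbsObjective, logEuclideanTrace]
  linarith

theorem logEuclideanTrace_pos [Nonempty n] (α : ℝ) (ρ σ : Matrix n n ℂ) :
    0 < logEuclideanTrace α ρ σ :=
  trace_matExp_pos (isHermitian_logEuclidean α ρ σ)

theorem continuousOn_gibbsObjective (α : ℝ) (ρ σ : Matrix n n ℂ) :
    ContinuousOn (gibbsObjective α ρ σ) {τ | IsState τ} :=
  (((continuous_traceLog ρ).const_mul α).add
    ((continuous_traceLog σ).const_mul (1 - α))).continuousOn.sub continuousOn_traceLog_self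

end Gibbs

/-! ### Comparison of kernel projectors -/

section KernelWeight

open Matrix

variable {n : Type*} [Fintype n] [DecidableEq n]

/-- The weight of a state on the kernel decreases as the support grows. -/
theorem sum_weight_ker_le {ρ σ : Matrix n n ℂ} (hρ : ρ.PosSemidef)
    (h : supp ρ ≤ supp σ) {U V : Matrix n n ℂ} {r s : n → ℝ} (hr : IsSpectral U r ρ)
    (hs : IsSpectral V s σ) {τ : Matrix n n ℂ} (hτ : τ.PosSemidef) :
    ∑ j, weight V τ j * (if s j = 0 then 1 else 0)
      ≤ ∑ j, weight U τ j * (if r j = 0 then 1 else 0) := by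
  have hP := hr.cfc (fun x => if x = 0 then (1 : ℝ) else 0)
  have hQ := hs.cfc (fun x => if x = 0 then (1 : ℝ) else 0)
  set P := cfc (fun x => if x = 0 then (1 : ℝ) else 0) ρ
  set Q := cfc (fun x => if x = 0 then (1 : ℝ) else 0) σ
  rw [← hP.trace_mul, ← hQ.trace_mul]
  rw [hs.supp_le_iff hρ] at h
  have hρQ : ρ * Q = 0 := by
    have h1 : ρ * V * diagonal (fun j => ((if s j = 0 then (1 : ℝ) else 0 : ℝ) : ℂ)) = 0 := by
      ext i j
      rw [mul_diagonal]
      split_ifs with hj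
      · have := congrFun (mulVec_col_eq_zero hρ (h j hj)) i
        simpa [mulVec, dotProduct, Matrix.mul_apply] using this
      · simp
    rw [hQ.eq, ← Matrix.mul_assoc, ← Matrix.mul_assoc, h1, Matrix.zero_mul]
  -- With the pseudo-inverse of `ρ`, the identity splits as `P + ρ⁻¹ρ`, so `ρ Q = 0` gives `P Q =
  -- Q`.
  have hR := hr.cfc (fun x => x⁻¹)
  have hPR : P + cfc (fun x : ℝ => x⁻¹) ρ * ρ = 1 := by
    have h1 := (hP.add (hR.mul hr)).eq
    have h2 := (hr.smul_one 1).eq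
    have h3 : ∀ j, (if r j = 0 then (1 : ℝ) else 0) + (r j)⁻¹ * r j = 1 := by
      intro j
      split_ifs with hj
      · simp [hj]
      · simp [inv_mul_cancel₀ hj]
    simp only [h3] at h1
    rw [h1, ← h2, one_smul]
  have hPQ : P * Q = Q := by
    calc P * Q = (P + cfc (fun x : ℝ => x⁻¹) ρ * ρ) * Q := by
          rw [Matrix.add_mul, Matrix.mul_assoc, hρQ, Matrix.mul_zero, add_zero]
      _ = Q := by rw [hPR, Matrix.one_mul]
  have hQP : Q * P = Q := by
    have := congrArg conjTranspose hPQ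
    rwa [conjTranspose_mul, hP.isHermitian.eq, hQ.isHermitian.eq] at this
  have hidem : ∀ x : ℝ, (if x = 0 then (1 : ℝ) else 0) * (if x = 0 then (1 : ℝ) else 0)
      = if x = 0 then (1 : ℝ) else 0 := fun x => by split_ifs <;> simp
  have hPP : P * P = P := by
    have := (hP.mul hP).eq
    simp only [hidem] at this
    rw [this, ← hP.eq]
  have hQQ : Q * Q = Q := by
    have := (hQ.mul hQ).eq
    simp only [hidem] at this
    rw [this, ← hQ.eq]
  -- Since `Q` is a subprojector of `P`, the difference is itself a projector.
  have hpsd : (P - Q).PosSemidef := by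
    have h1 : P - Q = (P - Q)ᴴ * (P - Q) := by
      rw [conjTranspose_sub, hP.isHermitian.eq, hQ.isHermitian.eq, Matrix.sub_mul, Matrix.mul_sub,
        Matrix.mul_sub, hPP, hPQ, hQP, hQQ]
      abel
    rw [h1]
    exact posSemidef_conjTranspose_mul_self _
  obtain ⟨W, e, he⟩ := exists_isSpectral hpsd.1
  have h1 : 0 ≤ (τ * (P - Q)).trace.re := by
    rw [he.trace_mul]
    exact Finset.sum_nonneg fun j _ => mul_nonneg (weight_nonneg hτ W j) (he.nonneg hpsd j)
  rw [Matrix.mul_sub, trace_sub, Complex.sub_re] at h1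
  linarith

end KernelWeight

/-! ### The regularised limit and the variational formula -/

section Limit

open Matrix

variable {n : Type*} [Fintype n] [DecidableEq n]

theorem tendsto_gibbsObjective {α : ℝ} {ρ σ τ : Matrix n n ℂ} (hρ : ρ.PosSemidef)
    (hσ : σ.PosSemidef) (hτ : τ.PosSemidef) (h1 : supp τ ≤ supp ρ) (h2 : supp τ ≤ supp σ) :
    Tendsto (fun ε : ℝ => gibbsObjective α (ρ + ε • (1 : Matrix n n ℂ))
      (σ + ε • (1 : Matrix n n ℂ)) τ) (𝓝[>] 0) (𝓝 (gibbsObjective α ρ σ τ)) :=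
  (((tendsto_traceLog_add_smul_one hρ hτ h1).const_mul α).add
    ((tendsto_traceLog_add_smul_one hσ hτ h2).const_mul (1 - α))).sub_const _

/-- The regularised eigenvalue function that bounds the regularised Gibbs objective. -/
noncomputable def regLog (α ε x : ℝ) : ℝ :=
  if x = 0 then Real.logb 2 ε else α * Real.logb 2 (x + ε)

theorem regLog_mono {α : ℝ} (hα : 1 < α) {ε ε' x : ℝ} (hε : 0 < ε) (h : ε ≤ ε') (hx : 0 ≤ x) :
    regLog α ε x ≤ regLog α ε' x := by
  unfold regLog
  split_ifs with hx0
  · exact Real.logb_le_logb_of_le one_lt_two hε h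
  · exact mul_le_mul_of_nonneg_left
      (Real.logb_le_logb_of_le one_lt_two (by linarith) (by linarith)) (by linarith)

/-- On the kernels, `ρ` contributes `α log ε` and `σ` contributes `(1 - α) log ε`, with opposite
signs. The kernel weight of `σ` is the smaller one, so at least one full `log ε` per unit of kernel
weight of `ρ` survives. The resulting bound is monotone in `ε`, as the Dini argument requires. -/
theorem gibbsObjective_add_smul_one_le {α : ℝ} (hα : 1 < α) {ρ σ τ : Matrix n n ℂ}
    (hρ : ρ.PosSemidef) (hσ : σ.PosSemidef) (h : supp ρ ≤ supp σ) (hτ : τ.PosSemidef)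
    {U : Matrix n n ℂ} {r : n → ℝ} (hr : IsSpectral U r ρ) {ε : ℝ} (hε : 0 < ε) (hε1 : ε < 1) :
    gibbsObjective α (ρ + ε • (1 : Matrix n n ℂ)) (σ + ε • (1 : Matrix n n ℂ)) τ
      ≤ ∑ j, weight U τ j * regLog α ε (r j) + (1 - α) * traceLog τ σ - traceLog τ τ := by
  obtain ⟨V, s, hs⟩ := exists_isSpectral hσ.1
  have hker := sum_weight_ker_le hρ h hr hs hτ
  have hlog : Real.logb 2 ε < 0 := Real.logb_neg one_lt_two hε hε1
  have e1 : α * traceLog τ (ρ + ε • (1 : Matrix n n ℂ))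
      = ∑ j, weight U τ j * regLog α ε (r j)
        + (α - 1) * Real.logb 2 ε * ∑ j, weight U τ j * (if r j = 0 then 1 else 0) := by
    rw [(hr.add (hr.smul_one ε)).traceLog, Finset.mul_sum, Finset.mul_sum,
      ← Finset.sum_add_distrib]
    refine Finset.sum_congr rfl fun j _ => ?_
    unfold regLog
    split_ifs with hj
    · rw [hj, zero_add]; ring
    · ring
  have e2 : traceLog τ σ + Real.logb 2 ε * ∑ j, weight V τ j * (if s j = 0 then 1 else 0)
      ≤ traceLog τ (σ + ε • (1 : Matrix n n ℂ)) := by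
    rw [(hs.add (hs.smul_one ε)).traceLog, hs.traceLog, Finset.mul_sum,
      ← Finset.sum_add_distrib]
    refine Finset.sum_le_sum fun j _ => ?_
    split_ifs with hj
    · rw [hj, zero_add, Real.logb_zero]; linarith
    · have h1 : 0 < s j := lt_of_le_of_ne (hs.nonneg hσ j) (Ne.symm hj)
      have h2 := mul_le_mul_of_nonneg_left
        (Real.logb_le_logb_of_le one_lt_two h1 (by linarith : s j ≤ s j + ε))
        (weight_nonneg hτ V j)
      linarith
  have e3 := mul_le_mul_of_nonneg_left e2 (by linarith : 0 ≤ α - 1)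
  have e4 := mul_le_mul_of_nonpos_left hker
    (mul_nonpos_of_nonneg_of_nonpos (by linarith : 0 ≤ α - 1) hlog.le)
  rw [gibbsObjective, e1]
  linarith

/-- The limit of the regularised traces is finite if the supports are nested. -/
theorem exists_tendsto_logEuclideanTrace {α : ℝ} (hα : 1 < α) {ρ σ : Matrix n n ℂ}
    (hρ : IsState ρ) (hσ : σ.PosSemidef) (h : supp ρ ≤ supp σ) :
    ∃ M : ℝ, IsLUB (gibbsObjective α ρ σ '' supportedStates ρ) M ∧
      Tendsto (fun ε : ℝ => Real.logb 2 (logEuclideanTrace α (ρ + ε • (1 : Matrix n n ℂ))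
        (σ + ε • (1 : Matrix n n ℂ)))) (𝓝[>] 0) (𝓝 M) := by
  have := hρ.nonempty
  obtain ⟨τ₁, hτ₁, hmax⟩ := (isCompact_supportedStates hρ.1.1).exists_isMaxOn
    ⟨ρ, hρ, le_rfl⟩ ((continuousOn_gibbsObjective α ρ σ).mono fun τ hτ => hτ.1)
  refine ⟨gibbsObjective α ρ σ τ₁, IsGreatest.isLUB ⟨⟨τ₁, hτ₁, rfl⟩, ?_⟩, ?_⟩
  · rintro _ ⟨τ, hτ, rfl⟩
    exact hmax hτ
  refine tendsto_order.mpr ⟨fun c hc => ?_, fun c hc => ?_⟩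
  -- Lower bound: the maximiser `τ₁` of the unregularised objective serves as a test state for every
  -- `ε`.
  · have h1 := (tendsto_order.mp (tendsto_gibbsObjective (α := α) hρ.1 hσ hτ₁.1.1 hτ₁.2
      (hτ₁.2.trans h))).1 c hc
    filter_upwards [h1] with ε hε
    exact hε.trans_le (gibbsObjective_le α _ _ hτ₁.1)
  obtain ⟨U, r, hr⟩ := exists_isSpectral hρ.1.1
  set B : ℝ → Matrix n n ℂ → ℝ := fun ε τ =>
    ∑ j, weight U τ j * regLog α ε (r j) + (1 - α) * traceLog τ σ - traceLog τ τ with hB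
  have hBcont : ∀ ε, ContinuousOn (B ε) {τ | IsState τ} := by
    intro ε
    refine ContinuousOn.sub (Continuous.continuousOn ?_) continuousOn_traceLog_self
    exact (continuous_finsetSum _ fun j _ => (continuous_weight U j).mul_const _).add
      ((continuous_traceLog σ).const_mul (1 - α))
  have hBmono : ∀ τ, IsState τ → ∀ ε ε', 0 < ε → ε ≤ ε' → B ε τ ≤ B ε' τ := by
    intro τ hτ ε ε' hε hεε'
    simp only [hB]
    gcongr with j
    · exact weight_nonneg hτ.1 U j
    · exact regLog_mono hα hε hεε' (hr.nonneg hρ.1 j)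
  have hlim : ∀ τ, IsState τ → ∀ᶠ ε in 𝓝[>] 0, B ε τ < c := by
    intro τ hτ
    by_cases hsupp : supp τ ≤ supp ρ
    · have h1 : gibbsObjective α ρ σ τ < c := lt_of_le_of_lt (hmax ⟨hτ, hsupp⟩) hc
      have h2 : Tendsto (fun ε => B ε τ) (𝓝[>] 0) (𝓝 (gibbsObjective α ρ σ τ)) := by
        refine (Tendsto.add_const _ ?_).sub_const _
        have h3 : α * traceLog τ ρ = ∑ j, weight U τ j * (α * Real.logb 2 (r j)) := by
          rw [hr.traceLog, Finset.mul_sum]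
          exact Finset.sum_congr rfl fun j _ => by ring
        rw [h3]
        refine tendsto_finsetSum _ fun j _ => ?_
        by_cases hj : r j = 0
        · simp [(hr.supp_le_iff hτ.1).mp hsupp j hj]
        · simp only [regLog, if_neg hj]
          refine Tendsto.const_mul _ (Tendsto.const_mul _
            (Tendsto.mono_left ?_ nhdsWithin_le_nhds))
          have h1 : ContinuousAt (fun ε : ℝ => Real.logb 2 (r j + ε)) 0 := by
            have : r j + 0 ≠ 0 := by simpa using hj
            unfold Real.logb
            fun_prop (disch := assumption)
          simpa [ContinuousAt] using h1
      exact h2.eventually_lt_const h1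
    · rw [hr.supp_le_iff hτ.1] at hsupp
      push Not at hsupp
      obtain ⟨j, hj, hwj⟩ := hsupp
      have h1 := tendsto_sum_mul_atBot (φ := regLog α) (weight_nonneg hτ.1 U) (hr.nonneg hρ.1)
        (fun ε hε hε1 x hx => regLog_mono hα hε hε1 hx)
        (by simpa [regLog] using tendsto_logb_two_nhdsGT_zero) hj hwj
      have h2 : Tendsto (fun ε => B ε τ) (𝓝[>] 0) atBot := by
        simp only [hB, add_sub_assoc]
        exact tendsto_atBot_add_const_right _ _ h1
      exact h2.eventually_lt_atBot c
  -- Dini's argument: the sets where `B ε ≥ c` are compact and shrink with `ε`. If none were empty,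
  -- a common point would contradict the pointwise bound `hlim`.
  have hunif : ∃ ε₀ > 0, ∀ τ, IsState τ → B ε₀ τ < c := by
    by_contra hcon
    push Not at hcon
    set e : ℕ → ℝ := fun m => 1 / ((m : ℝ) + 1)
    have he : ∀ m, 0 < e m := fun m => Nat.one_div_pos_of_nat
    have hK : (⋂ m, {τ | IsState τ} ∩ B (e m) ⁻¹' Set.Ici c).Nonempty := by
      refine IsCompact.nonempty_iInter_of_sequence_nonempty_isCompact_isClosed _ ?_ ?_ ?_ ?_
      · rintro m τ ⟨hτ, hτc⟩
        exact ⟨hτ, le_trans (Set.mem_Ici.mp hτc) (hBmono τ hτ _ _ (he _)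
          (Nat.one_div_le_one_div (Nat.le_succ m)))⟩
      · intro m
        obtain ⟨τ, hτ, hτc⟩ := hcon (e m) (he m)
        exact ⟨τ, hτ, hτc⟩
      · exact isCompact_setOf_isState.of_isClosed_subset
          ((hBcont _).preimage_isClosed_of_isClosed isCompact_setOf_isState.isClosed isClosed_Ici)
          Set.inter_subset_left
      · exact fun m => (hBcont _).preimage_isClosed_of_isClosed
          isCompact_setOf_isState.isClosed isClosed_Ici
    obtain ⟨τ, hτ⟩ := hK
    rw [Set.mem_iInter] at hτ
    have hτs : IsState τ := (hτ 0).1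
    have he0 : Tendsto e atTop (𝓝[>] 0) :=
      tendsto_nhdsWithin_of_tendsto_nhds_of_eventually_within _
        tendsto_one_div_add_atTop_nhds_zero_nat (Eventually.of_forall he)
    obtain ⟨m, hm⟩ := (he0.eventually (hlim τ hτs)).exists
    exact absurd (Set.mem_Ici.mp (hτ m).2) (not_le.mpr hm)
  obtain ⟨ε₀, hε₀, hlt⟩ := hunif
  filter_upwards [Ioo_mem_nhdsGT (lt_min hε₀ one_pos)] with ε hε
  obtain ⟨τ, hτ, hτeq⟩ := exists_gibbsObjective_eq α (ρ + ε • (1 : Matrix n n ℂ))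
    (σ + ε • (1 : Matrix n n ℂ))
  rw [← hτeq]
  calc _ ≤ B ε τ := gibbsObjective_add_smul_one_le hα hρ.1 hσ h hτ.1 hr hε.1
        (hε.2.trans_le (min_le_right _ _))
    _ ≤ B ε₀ τ := hBmono τ hτ _ _ hε.1 (hε.2.le.trans (min_le_left _ _))
    _ < c := hlt τ hτ

/-- The test state `ρ` suffices: `tr ρ log(σ + ε)` tends to `-∞` and carries the negative factor `1
- α`. -/
theorem tendsto_logEuclideanTrace_atTop {α : ℝ} (hα : 1 < α) {ρ σ : Matrix n n ℂ}
    (hρ : IsState ρ) (hσ : σ.PosSemidef) (h : ¬ supp ρ ≤ supp σ) :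
    Tendsto (fun ε : ℝ => Real.logb 2 (logEuclideanTrace α (ρ + ε • (1 : Matrix n n ℂ))
        (σ + ε • (1 : Matrix n n ℂ)))) (𝓝[>] 0) atTop := by
  refine tendsto_atTop_mono (fun ε => gibbsObjective_le α _ _ hρ) ?_
  refine tendsto_atTop_add_const_right _ _ (Tendsto.add_atTop
    ((tendsto_traceLog_add_smul_one hρ.1 hρ.1 le_rfl).const_mul α) ?_)
  exact (tendsto_traceLog_add_smul_one_atBot hσ hρ.1 h).const_mul_atBot_of_neg (by linarith)

theorem log2_ofReal {x : ℝ} (hx : 0 < x) :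
    log2 (ENNReal.ofReal x) = ((Real.logb 2 x : ℝ) : EReal) := by
  rw [log2, ENNReal.log_ofReal, if_neg hx.not_ge, ← EReal.coe_div, Real.logb]

theorem rpow_logb_logEuclideanTrace [Nonempty n] (α : ℝ) (ρ σ : Matrix n n ℂ) :
    (2 : ℝ) ^ Real.logb 2 (logEuclideanTrace α ρ σ) = logEuclideanTrace α ρ σ :=
  Real.rpow_logb two_pos (by norm_num) (logEuclideanTrace_pos α ρ σ)

/-- Variational formula for the log-Euclidean Rényi divergence. -/
theorem exists_isLUB_log2_logEuclideanQ {α : ℝ} (hα : 1 < α) {ρ σ : Matrix n n ℂ}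
    (hρ : IsState ρ) (hσ : σ.PosSemidef) (h : supp ρ ≤ supp σ) :
    ∃ M : ℝ, IsLUB (gibbsObjective α ρ σ '' supportedStates ρ) M ∧
      log2 (logEuclideanQ α ρ σ) = (M : EReal) := by
  have := hρ.nonempty
  by_cases hpd : ρ.PosDef ∧ σ.PosDef
  · refine ⟨Real.logb 2 (logEuclideanTrace α ρ σ), IsGreatest.isLUB ⟨?_, ?_⟩, ?_⟩
    · obtain ⟨τ, hτ, hτeq⟩ := exists_gibbsObjective_eq α ρ σ
      exact ⟨τ, ⟨hτ, supp_le_of_posDef hpd.1 hτ.1⟩, hτeq⟩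
    · rintro _ ⟨τ, hτ, rfl⟩
      exact gibbsObjective_le α ρ σ hτ.1
    · rw [logEuclideanQ, if_pos hpd, log2_ofReal (logEuclideanTrace_pos α ρ σ)]
  · obtain ⟨M, hM, hlim⟩ := exists_tendsto_logEuclideanTrace hα hρ hσ h
    refine ⟨M, hM, ?_⟩
    have h1 : Tendsto (fun ε : ℝ => ENNReal.ofReal (logEuclideanTrace α
        (ρ + ε • (1 : Matrix n n ℂ)) (σ + ε • (1 : Matrix n n ℂ)))) (𝓝[>] 0)
        (𝓝 (ENNReal.ofReal ((2 : ℝ) ^ M))) := by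
      refine Tendsto.congr (fun ε => congrArg _ (rpow_logb_logEuclideanTrace α _ _)) ?_
      exact ENNReal.tendsto_ofReal
        ((Real.continuous_const_rpow two_ne_zero).continuousAt.tendsto.comp hlim)
    rw [logEuclideanQ, if_neg hpd, h1.limUnder_eq, log2_ofReal (by positivity),
      Real.logb_rpow two_pos (by norm_num)]

theorem log2_logEuclideanQ_eq_top {α : ℝ} (hα : 1 < α) {ρ σ : Matrix n n ℂ}
    (hρ : IsState ρ) (hσ : σ.PosSemidef) (h : ¬ supp ρ ≤ supp σ) :
    log2 (logEuclideanQ α ρ σ) = ⊤ := by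
  have := hρ.nonempty
  have hpd : ¬ (ρ.PosDef ∧ σ.PosDef) := fun hpd => h (supp_le_of_posDef hpd.2 hρ.1)
  have h1 : Tendsto (fun ε : ℝ => ENNReal.ofReal (logEuclideanTrace α
      (ρ + ε • (1 : Matrix n n ℂ)) (σ + ε • (1 : Matrix n n ℂ)))) (𝓝[>] 0) (𝓝 ⊤) := by
    refine Tendsto.congr (fun ε => congrArg _ (rpow_logb_logEuclideanTrace α _ _)) ?_
    exact ENNReal.tendsto_ofReal_atTop.comp ((tendsto_rpow_atTop_of_base_gt_one 2
      one_lt_two).comp (tendsto_logEuclideanTrace_atTop hα hρ hσ h))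
  rw [logEuclideanQ, if_neg hpd, h1.limUnder_eq, log2, ENNReal.log_top]
  exact EReal.top_div_of_pos_ne_top (by exact_mod_cast Real.log_pos one_lt_two)
    (EReal.coe_ne_top _)

end Limit

end QInfo

namespace QInfo

/-! ### Reduced states and tensor products -/

section Bipartite

open Matrix

variable {A B : Type*} [Fintype A] [Fintype B]

theorem trace_reduceFst (X : Matrix (A × B) (A × B) ℂ) : (reduceFst X).trace = X.trace := by
  simp [Matrix.trace, reduceFst, Fintype.sum_prod_type]

theorem trace_reduceSnd (X : Matrix (A × B) (A × B) ℂ) : (reduceSnd X).trace = X.trace := by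
  simp [Matrix.trace, reduceSnd, Fintype.sum_prod_type_right]

omit [Fintype A] in
theorem posSemidef_reduceFst {X : Matrix (A × B) (A × B) ℂ} (hX : X.PosSemidef) :
    (reduceFst X).PosSemidef := by
  have : reduceFst X = ∑ k, X.submatrix (fun i => (i, k)) (fun i => (i, k)) := by
    ext i j
    simp [reduceFst, Matrix.sum_apply]
  rw [this]
  exact posSemidef_sum _ fun k _ => hX.submatrix _

omit [Fintype B] in
theorem posSemidef_reduceSnd {X : Matrix (A × B) (A × B) ℂ} (hX : X.PosSemidef) :
    (reduceSnd X).PosSemidef := by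
  have : reduceSnd X = ∑ k, X.submatrix (fun i => (k, i)) (fun i => (k, i)) := by
    ext i j
    simp [reduceSnd, Matrix.sum_apply]
  rw [this]
  exact posSemidef_sum _ fun k _ => hX.submatrix _

theorem IsState.reduceFst {X : Matrix (A × B) (A × B) ℂ} (hX : IsState X) :
    IsState (reduceFst X) :=
  ⟨posSemidef_reduceFst hX.1, (trace_reduceFst X).trans hX.2⟩

theorem IsState.reduceSnd {X : Matrix (A × B) (A × B) ℂ} (hX : IsState X) :
    IsState (reduceSnd X) :=
  ⟨posSemidef_reduceSnd hX.1, (trace_reduceSnd X).trans hX.2⟩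

omit [Fintype A] in
theorem reduceFst_add_smul (a b : ℝ) (X Y : Matrix (A × B) (A × B) ℂ) :
    reduceFst (a • X + b • Y) = a • reduceFst X + b • reduceFst Y := by
  ext i j
  simp [reduceFst, Finset.sum_add_distrib, Finset.mul_sum]

omit [Fintype B] in
theorem reduceSnd_add_smul (a b : ℝ) (X Y : Matrix (A × B) (A × B) ℂ) :
    reduceSnd (a • X + b • Y) = a • reduceSnd X + b • reduceSnd Y := by
  ext i j
  simp [reduceSnd, Finset.sum_add_distrib, Finset.mul_sum]

omit [Fintype A] in
theorem continuous_reduceFst :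
    Continuous (reduceFst : Matrix (A × B) (A × B) ℂ → Matrix A A ℂ) :=
  continuous_matrix fun _ _ => continuous_finsetSum _ fun _ _ => continuous_id.matrix_elem _ _

omit [Fintype B] in
theorem continuous_reduceSnd :
    Continuous (reduceSnd : Matrix (A × B) (A × B) ℂ → Matrix B B ℂ) :=
  continuous_matrix fun _ _ => continuous_finsetSum _ fun _ _ => continuous_id.matrix_elem _ _

variable [DecidableEq A] [DecidableEq B]

theorem IsSpectral.kronecker {U X : Matrix A A ℂ} {V Y : Matrix B B ℂ} {d : A → ℝ} {e : B → ℝ}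
    (hX : IsSpectral U d X) (hY : IsSpectral V e Y) :
    IsSpectral (U ⊗ₖ V) (fun p => d p.1 * e p.2) (X ⊗ₖ Y) := by
  refine ⟨?_, ?_⟩
  · rw [conjTranspose_kronecker, ← mul_kronecker_mul, hX.conjTranspose_mul, hY.conjTranspose_mul,
      one_kronecker_one]
  · conv_lhs => rw [hX.eq, hY.eq]
    rw [conjTranspose_kronecker, mul_kronecker_mul, mul_kronecker_mul,
      diagonal_kronecker_diagonal]
    simp

omit [DecidableEq A] in
-- Summing over a complete orthonormal basis of the second system is the partial trace.
theorem sum_weight_kronecker_fst {U : Matrix A A ℂ} {V : Matrix B B ℂ} (hV : V * Vᴴ = 1)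
    (X : Matrix (A × B) (A × B) ℂ) (a : A) :
    ∑ b, weight (U ⊗ₖ V) X (a, b) = weight U (reduceFst X) a := by
  have hV' : ∀ k l, ∑ b, V k b * star (V l b) = if k = l then 1 else 0 := by
    intro k l
    have := congrFun (congrFun hV k) l
    rwa [Matrix.mul_apply, one_apply] at this
  simp only [weight, ← Complex.re_sum]
  congr 1
  calc ∑ b, ((U ⊗ₖ V)ᴴ * X * (U ⊗ₖ V)) (a, b) (a, b)
      = ∑ b, ∑ j, ∑ l, ∑ i, ∑ k,
          star (U i a) * X (i, k) (j, l) * U j a * (V l b * star (V k b)) := by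
        refine Finset.sum_congr rfl fun b _ => ?_
        rw [Matrix.mul_apply, Fintype.sum_prod_type]
        refine Finset.sum_congr rfl fun j _ => Finset.sum_congr rfl fun l _ => ?_
        rw [Matrix.mul_apply, Fintype.sum_prod_type, Finset.sum_mul]
        refine Finset.sum_congr rfl fun i _ => ?_
        rw [Finset.sum_mul]
        refine Finset.sum_congr rfl fun k _ => ?_
        simp only [conjTranspose_apply, kroneckerMap_apply, star_mul']
        ring
    _ = ∑ j, ∑ l, ∑ i, ∑ k,
          star (U i a) * X (i, k) (j, l) * U j a * (if l = k then 1 else 0) := by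
        simp only [← hV', Finset.mul_sum]
        rw [Finset.sum_comm]
        refine Finset.sum_congr rfl fun j _ => ?_
        rw [Finset.sum_comm]
        refine Finset.sum_congr rfl fun l _ => ?_
        rw [Finset.sum_comm]
        refine Finset.sum_congr rfl fun i _ => ?_
        rw [Finset.sum_comm]
    _ = (Uᴴ * reduceFst X * U) a a := by
        rw [Matrix.mul_apply]
        refine Finset.sum_congr rfl fun j _ => ?_
        rw [Matrix.mul_apply, Finset.sum_mul, Finset.sum_comm]
        refine Finset.sum_congr rfl fun i _ => ?_
        simp [reduceFst, Finset.mul_sum, Finset.sum_mul]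

omit [DecidableEq B] in
theorem sum_weight_kronecker_snd {U : Matrix A A ℂ} {V : Matrix B B ℂ} (hU : U * Uᴴ = 1)
    (X : Matrix (A × B) (A × B) ℂ) (b : B) :
    ∑ a, weight (U ⊗ₖ V) X (a, b) = weight V (reduceSnd X) b := by
  have h := sum_weight_kronecker_fst (U := V) (V := U) hU (X.submatrix Prod.swap Prod.swap) b
  have h1 : reduceFst (X.submatrix Prod.swap Prod.swap) = reduceSnd X := rfl
  rw [← h1, ← h]
  refine Finset.sum_congr rfl fun a _ => ?_
  have h2 : (V ⊗ₖ U) = (U ⊗ₖ V).submatrix Prod.swap Prod.swap := by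
    ext i j
    simp [mul_comm]
  simp only [weight]
  rw [h2, conjTranspose_submatrix]
  have h4 : ∀ M N : Matrix (A × B) (A × B) ℂ,
      M.submatrix (Prod.swap : B × A → A × B) (Prod.swap : B × A → A × B)
        * N.submatrix (Prod.swap : B × A → A × B) (Prod.swap : B × A → A × B)
      = (M * N).submatrix Prod.swap Prod.swap := fun M N =>
    submatrix_mul_equiv M N Prod.swap (Equiv.prodComm B A) Prod.swap
  rw [h4, h4]
  rfl

/-- Weights of the reduced states are sums of nonnegative joint weights, so a marginal weight
vanishes exactly when all its joint weights do. -/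
theorem supp_le_kronecker_iff {X : Matrix A A ℂ} {Y : Matrix B B ℂ} (hX : X.IsHermitian)
    (hY : Y.IsHermitian) {τ : Matrix (A × B) (A × B) ℂ} (hτ : τ.PosSemidef) :
    supp τ ≤ supp (X ⊗ₖ Y) ↔ supp (reduceFst τ) ≤ supp X ∧ supp (reduceSnd τ) ≤ supp Y := by
  obtain ⟨U, d, hd⟩ := exists_isSpectral hX
  obtain ⟨V, e, he⟩ := exists_isSpectral hY
  rw [(hd.kronecker he).supp_le_iff hτ, hd.supp_le_iff (posSemidef_reduceFst hτ),
    he.supp_le_iff (posSemidef_reduceSnd hτ)]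
  simp only [← sum_weight_kronecker_fst (U := U) he.mul_conjTranspose,
    ← sum_weight_kronecker_snd (V := V) hd.mul_conjTranspose]
  have hnn := weight_nonneg hτ (U ⊗ₖ V)
  constructor
  · intro h
    exact ⟨fun a ha => Finset.sum_eq_zero fun b _ => h (a, b) (by simp [ha]),
      fun b hb => Finset.sum_eq_zero fun a _ => h (a, b) (by simp [hb])⟩
  · rintro ⟨h1, h2⟩ ⟨a, b⟩ hab
    rcases mul_eq_zero.mp hab with ha | hb
    · exact (Finset.sum_eq_zero_iff_of_nonneg fun b _ => hnn (a, b)).mp (h1 a ha) b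
        (Finset.mem_univ b)
    · exact (Finset.sum_eq_zero_iff_of_nonneg fun a _ => hnn (a, b)).mp (h2 b hb) a
        (Finset.mem_univ a)

theorem supp_le_reduce {τ : Matrix (A × B) (A × B) ℂ} (hτ : τ.PosSemidef) :
    supp τ ≤ supp (reduceFst τ ⊗ₖ reduceSnd τ) :=
  (supp_le_kronecker_iff (posSemidef_reduceFst hτ).1 (posSemidef_reduceSnd hτ).1 hτ).mpr
    ⟨le_rfl, le_rfl⟩

theorem supp_reduceFst_le {τ ρ : Matrix (A × B) (A × B) ℂ} (hτ : τ.PosSemidef)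
    (hρ : ρ.PosSemidef) (h : supp τ ≤ supp ρ) : supp (reduceFst τ) ≤ supp (reduceFst ρ) :=
  ((supp_le_kronecker_iff (posSemidef_reduceFst hρ).1 (posSemidef_reduceSnd hρ).1 hτ).mp
    (h.trans (supp_le_reduce hρ))).1

/-- The logarithm of a product of eigenvalues splits only when both are nonzero; the support
hypothesis gives the remaining pairs weight zero. -/
theorem traceLog_kronecker {X : Matrix A A ℂ} {Y : Matrix B B ℂ} (hX : X.IsHermitian)
    (hY : Y.IsHermitian) {τ : Matrix (A × B) (A × B) ℂ} (hτ : τ.PosSemidef)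
    (h : supp τ ≤ supp (X ⊗ₖ Y)) :
    traceLog τ (X ⊗ₖ Y) = traceLog (reduceFst τ) X + traceLog (reduceSnd τ) Y := by
  obtain ⟨U, d, hd⟩ := exists_isSpectral hX
  obtain ⟨V, e, he⟩ := exists_isSpectral hY
  rw [(hd.kronecker he).supp_le_iff hτ] at h
  rw [(hd.kronecker he).traceLog, hd.traceLog, he.traceLog]
  simp only [← sum_weight_kronecker_fst (U := U) he.mul_conjTranspose,
    ← sum_weight_kronecker_snd (V := V) hd.mul_conjTranspose, Finset.sum_mul]
  rw [Finset.sum_comm (s := (Finset.univ : Finset B)), Fintype.sum_prod_type, ← Finset.sum_add_distrib]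
  refine Finset.sum_congr rfl fun a _ => ?_
  rw [← Finset.sum_add_distrib]
  refine Finset.sum_congr rfl fun b _ => ?_
  by_cases h0 : d a * e b = 0
  · simp [h (a, b) h0]
  · rw [Real.logb_mul (left_ne_zero_of_mul h0) (right_ne_zero_of_mul h0), mul_add]

end Bipartite

/-! ### Channels acting on one half of a state -/

section Channels

open Matrix

variable {A A' B : Type*} [Fintype A] [Fintype A'] [Fintype B]
  {N : Matrix A' A' ℂ →ₗ[ℂ] Matrix B B ℂ}

omit [Fintype A] in
theorem IsChannel.reduceFst_applySnd (hN : IsChannel N) (X : Matrix (A × A') (A × A') ℂ) :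
    reduceFst (applySnd N X) = reduceFst X := by
  ext i j
  exact hN.tracePreserving (Matrix.of fun k l => X (i, k) (j, l))

theorem IsChannel.isState_applySnd (hN : IsChannel N) {X : Matrix (A × A') (A × A') ℂ}
    (hX : IsState X) : IsState (applySnd N X) := by
  refine ⟨?_, ?_⟩
  -- Complete positivity is formulated for ancillas `Fin k`, so `A` is relabelled.
  · let e := Fintype.equivFin A
    have h := hN.completelyPositive _
      (X.submatrix (Prod.map e.symm id) (Prod.map e.symm id)) (hX.1.submatrix _)
    exact (posSemidef_submatrix_equiv (e.symm.prodCongr (Equiv.refl B))).mp h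
  · rw [← trace_reduceFst, hN.reduceFst_applySnd, trace_reduceFst, hX.2]

end Channels

end QInfo

namespace QInfo

/-! ### Saddle point and the optimal `σ` -/

section Saddle

open Matrix

variable {A B : Type*} [Fintype A] [DecidableEq A] [Fintype B] [DecidableEq B]

/-- The relative entropy of `τ` and `ρ` as a real number. -/
noncomputable def relEnt {n : Type*} [Fintype n] [DecidableEq n] (ρ τ : Matrix n n ℂ) : ℝ :=
  traceLog τ τ - traceLog τ ρ

/-- The relative entropy of `τ` and `ρ_A ⊗ τ_B` as a real number. -/
noncomputable def mutualInfo (ρ τ : Matrix (A × B) (A × B) ℂ) : ℝ :=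
  traceLog τ τ - traceLog (reduceFst τ) (reduceFst ρ)
    - traceLog (reduceSnd τ) (reduceSnd τ)

/-- The difference of `D(τ‖ρ)` and `s D(τ‖ρ_A ⊗ σ)` as a real number. -/
noncomputable def relEntDiff (s : ℝ) (ρ : Matrix (A × B) (A × B) ℂ) (σ : Matrix B B ℂ)
    (τ : Matrix (A × B) (A × B) ℂ) : ℝ :=
  (1 - s) * traceLog τ τ + s * (traceLog (reduceFst τ) (reduceFst ρ) + traceLog (reduceSnd τ) σ)
    - traceLog τ ρ

theorem relEntDiff_reduceSnd (s : ℝ) (ρ τ : Matrix (A × B) (A × B) ℂ) :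
    relEntDiff s ρ (reduceSnd τ) τ = relEnt ρ τ - s * mutualInfo ρ τ := by
  rw [relEntDiff, relEnt, mutualInfo]
  ring

theorem relEntropy_eq_relEnt {n : Type*} [Fintype n] [DecidableEq n] {ρ τ : Matrix n n ℂ}
    (h : supp τ ≤ supp ρ) : relEntropy τ ρ = (relEnt ρ τ : ℝ) := by
  rw [relEntropy, if_pos h, Matrix.mul_sub, trace_sub, Complex.sub_re]
  rfl

theorem supp_le_kronecker_reduceSnd {ρ τ : Matrix (A × B) (A × B) ℂ} (hρ : IsState ρ)
    (hτ : τ ∈ supportedStates ρ) : supp τ ≤ supp (reduceFst ρ ⊗ₖ reduceSnd τ) :=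
  (supp_le_kronecker_iff (posSemidef_reduceFst hρ.1).1 (posSemidef_reduceSnd hτ.1.1).1
    hτ.1.1).mpr ⟨supp_reduceFst_le hτ.1.1 hρ.1 hτ.2, le_rfl⟩

theorem relEntropy_eq_mutualInfo {ρ τ : Matrix (A × B) (A × B) ℂ} (hρ : IsState ρ)
    (hτ : τ ∈ supportedStates ρ) :
    relEntropy τ (reduceFst ρ ⊗ₖ reduceSnd τ) = (mutualInfo ρ τ : ℝ) := by
  have h := supp_le_kronecker_reduceSnd hρ hτ
  rw [relEntropy_eq_relEnt h, relEnt, traceLog_kronecker (posSemidef_reduceFst hρ.1).1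
    (posSemidef_reduceSnd hτ.1.1).1 hτ.1.1 h, mutualInfo, sub_sub]

theorem continuousOn_relEnt {n : Type*} [Fintype n] [DecidableEq n] (ρ : Matrix n n ℂ) :
    ContinuousOn (relEnt ρ) (supportedStates ρ) :=
  (continuousOn_traceLog_self.mono fun _ h => h.1).sub (continuous_traceLog ρ).continuousOn

theorem continuousOn_mutualInfo (ρ : Matrix (A × B) (A × B) ℂ) :
    ContinuousOn (mutualInfo ρ) (supportedStates ρ) := by
  refine ((continuousOn_traceLog_self.mono fun _ h => h.1).sub
    ((continuous_traceLog _).comp continuous_reduceFst).continuousOn).sub ?_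
  exact continuousOn_traceLog_self.comp (f := reduceSnd) continuous_reduceSnd.continuousOn
    fun _ h => h.1.reduceSnd

theorem convexOn_relEnt {n : Type*} [Fintype n] [DecidableEq n] (ρ : Matrix n n ℂ) :
    ConvexOn ℝ (supportedStates ρ) (relEnt ρ) := by
  refine ⟨convex_supportedStates ρ, fun X hX Y hY a b ha hb hab => ?_⟩
  have h := convexOn_traceLog_self.2 hX.1 hY.1 ha hb hab
  simp only [smul_eq_mul, relEnt] at h ⊢
  rw [traceLog_add_smul a b X Y ρ]
  linarith

/-- The terms `tr τ log τ` cancel, leaving `tr τ_B log τ_B` and linear terms. -/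
theorem convexOn_relEnt_sub_mutualInfo (ρ : Matrix (A × B) (A × B) ℂ) :
    ConvexOn ℝ (supportedStates ρ) fun τ => relEnt ρ τ - mutualInfo ρ τ := by
  refine ⟨convex_supportedStates ρ, fun X hX Y hY a b ha hb hab => ?_⟩
  have h := convexOn_traceLog_self.2 hX.1.reduceSnd hY.1.reduceSnd ha hb hab
  simp only [smul_eq_mul, relEnt, mutualInfo] at h ⊢
  rw [traceLog_add_smul a b X Y ρ, reduceFst_add_smul, traceLog_add_smul a b (reduceFst X),
    reduceSnd_add_smul]
  linarith

/-- Existence of a saddle point `(τ, τ_B)` of `D(τ‖ρ) - s D(τ‖ρ_A ⊗ σ)`. -/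
theorem exists_saddle {ρ : Matrix (A × B) (A × B) ℂ} (hρ : IsState ρ) {s : ℝ} (hs : 0 < s)
    (hs1 : s < 1) :
    ∃ τ₀ ∈ supportedStates ρ, ∀ τ ∈ supportedStates ρ,
      relEnt ρ τ₀ - s * mutualInfo ρ τ₀ ≤ relEnt ρ τ - s * mutualInfo ρ τ ∧
      supp (reduceSnd τ) ≤ supp (reduceSnd τ₀) ∧
      relEnt ρ τ₀ - s * mutualInfo ρ τ₀ ≤ relEntDiff s ρ (reduceSnd τ₀) τ := by
  obtain ⟨τ₀, hτ₀, hmin⟩ := (isCompact_supportedStates hρ.1.1).exists_isMinOn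
    ⟨ρ, hρ, le_rfl⟩ ((continuousOn_relEnt ρ).sub ((continuousOn_mutualInfo ρ).const_mul s))
  refine ⟨τ₀, hτ₀, fun τ hτ => ⟨hmin hτ, ?_⟩⟩
  set v := relEnt ρ τ₀ - s * mutualInfo ρ τ₀ with hv
  -- Move from `τ₀` towards `τ` by `l` to get `Z`, and freeze `σ = Z_B`. Minimality bounds the value
  -- at `Z` below by `v`, Klein's inequality bounds the value at `τ₀` above by `v`, and convexity
  -- then forces the value at `τ` to be at least `v`.
  have key : ∀ l : ℝ, 0 < l → l < 1 →
      v ≤ relEntDiff s ρ ((1 - l) • reduceSnd τ₀ + l • reduceSnd τ) τ := by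
    intro l hl hl1
    have hl1' : 0 < 1 - l := by linarith
    set Z := (1 - l) • τ₀ + l • τ with hZ
    have hZs : Z ∈ supportedStates ρ :=
      convex_supportedStates ρ hτ₀ hτ hl1'.le hl.le (by ring)
    have hZB : reduceSnd Z = (1 - l) • reduceSnd τ₀ + l • reduceSnd τ := reduceSnd_add_smul _ _ _ _
    have h1 : v ≤ relEntDiff s ρ (reduceSnd Z) Z := by
      rw [relEntDiff_reduceSnd]; exact hmin hZs
    have h2 : relEntDiff s ρ (reduceSnd Z) τ₀ ≤ v := by
      rw [hv, ← relEntDiff_reduceSnd, relEntDiff, relEntDiff]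
      gcongr
      refine hτ₀.1.reduceSnd.traceLog_le hZs.1.reduceSnd ?_
      rw [hZB]
      exact supp_le_mix_left (posSemidef_reduceSnd hτ₀.1.1) (posSemidef_reduceSnd hτ.1.1)
        hl1' hl.le
    have h3 : relEntDiff s ρ (reduceSnd Z) Z ≤ (1 - l) * relEntDiff s ρ (reduceSnd Z) τ₀
        + l * relEntDiff s ρ (reduceSnd Z) τ := by
      have hconv := mul_le_mul_of_nonneg_left
        (convexOn_traceLog_self.2 hτ₀.1 hτ.1 hl1'.le hl.le (by ring))
        (by linarith : 0 ≤ 1 - s)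
      have hB : ∀ W : Matrix B B ℂ, traceLog (reduceSnd Z) W
          = (1 - l) * traceLog (reduceSnd τ₀) W + l * traceLog (reduceSnd τ) W := fun W => by
        rw [hZB, traceLog_add_smul]
      have hA : traceLog (reduceFst Z) (reduceFst ρ)
          = (1 - l) * traceLog (reduceFst τ₀) (reduceFst ρ)
            + l * traceLog (reduceFst τ) (reduceFst ρ) := by
        rw [hZ, reduceFst_add_smul, traceLog_add_smul]
      have hE : traceLog Z ρ = (1 - l) * traceLog τ₀ ρ + l * traceLog τ ρ := by
        rw [hZ, traceLog_add_smul]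
      simp only [smul_eq_mul, ← hZ] at hconv
      simp only [relEntDiff]
      rw [hB, hA, hE]
      linarith
    have h4 := mul_le_mul_of_nonneg_left h2 hl1'.le
    rw [← hZB]
    by_contra hcon
    push Not at hcon
    have h5 := mul_lt_mul_of_pos_left hcon hl
    linarith
  -- Solving for the only term containing `σ` puts `key` in the form needed for the limit `l → 0`,
  -- which also yields the support inclusion.
  set c := (v - ((1 - s) * traceLog τ τ + s * traceLog (reduceFst τ) (reduceFst ρ)
    - traceLog τ ρ)) / s with hc
  have hiff : ∀ W : Matrix B B ℂ, c ≤ traceLog (reduceSnd τ) W ↔ v ≤ relEntDiff s ρ W τ := by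
    intro W
    rw [hc, div_le_iff₀ hs, relEntDiff]
    constructor <;> intro h <;> linarith
  obtain ⟨h1, h2⟩ := hτ₀.1.reduceSnd.le_traceLog_of_mix hτ.1.reduceSnd (c := c)
    fun l hl hl1 => (hiff _).mpr (key l hl hl1)
  exact ⟨h1, (hiff _).mp h2⟩

theorem gibbsObjective_kronecker {α : ℝ} (hα : 1 < α) {ρ τ : Matrix (A × B) (A × B) ℂ}
    (hρ : IsState ρ) (hτ : IsState τ) {σ : Matrix B B ℂ} (hσ : IsState σ)
    (h : supp τ ≤ supp (reduceFst ρ ⊗ₖ σ)) :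
    gibbsObjective α ρ (reduceFst ρ ⊗ₖ σ) τ = -α * relEntDiff ((α - 1) / α) ρ σ τ := by
  rw [gibbsObjective, relEntDiff, traceLog_kronecker (posSemidef_reduceFst hρ.1).1 hσ.1.1 hτ.1 h]
  have : α ≠ 0 := by linarith
  field_simp
  ring

/-- The log-Euclidean Rényi information of a bipartite state. -/
theorem exists_iInf_logEuclideanDiv_eq {ρ : Matrix (A × B) (A × B) ℂ} (hρ : IsState ρ) {α : ℝ}
    (hα : 1 < α) :
    ∃ τ₀ ∈ supportedStates ρ,
      (∀ τ ∈ supportedStates ρ, relEnt ρ τ₀ - (α - 1) / α * mutualInfo ρ τ₀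
        ≤ relEnt ρ τ - (α - 1) / α * mutualInfo ρ τ) ∧
      ⨅ (σ : Matrix B B ℂ) (_ : IsState σ), logEuclideanDiv α ρ (reduceFst ρ ⊗ₖ σ)
        = ((-(α / (α - 1)) * (relEnt ρ τ₀ - (α - 1) / α * mutualInfo ρ τ₀) : ℝ) : EReal) := by
  have hα0 : 0 < α := by linarith
  have hα1 : 0 < α - 1 := by linarith
  obtain ⟨τ₀, hτ₀, hsaddle⟩ := exists_saddle hρ (s := (α - 1) / α) (by positivity)
    (by rw [div_lt_one hα0]; linarith)
  refine ⟨τ₀, hτ₀, fun τ hτ => (hsaddle τ hτ).1, ?_⟩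
  set v := relEnt ρ τ₀ - (α - 1) / α * mutualInfo ρ τ₀ with hv
  have hval : ∀ M : ℝ, ((1 / (α - 1) : ℝ) : EReal) * (M : EReal)
      = ((1 / (α - 1) * M : ℝ) : EReal) := fun M => (EReal.coe_mul _ _).symm
  have hval' : -(α / (α - 1)) * v = 1 / (α - 1) * (-α * v) := by ring
  have hA := (posSemidef_reduceFst hρ.1)
  refine le_antisymm ?_ (le_iInf₂ fun σ hσ => ?_)
  -- Upper bound: take `σ = τ₀_B` and apply the saddle inequality to every `τ`.
  · refine iInf₂_le_of_le (reduceSnd τ₀) hτ₀.1.reduceSnd ?_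
    have hsupp : ∀ τ ∈ supportedStates ρ, supp τ ≤ supp (reduceFst ρ ⊗ₖ reduceSnd τ₀) :=
      fun τ hτ => (supp_le_kronecker_iff hA.1 (posSemidef_reduceSnd hτ₀.1.1).1 hτ.1.1).mpr
        ⟨supp_reduceFst_le hτ.1.1 hρ.1 hτ.2, (hsaddle τ hτ).2.1⟩
    obtain ⟨M, hM, hlog⟩ := exists_isLUB_log2_logEuclideanQ hα hρ
      (hA.kronecker (posSemidef_reduceSnd hτ₀.1.1)) (hsupp ρ ⟨hρ, le_rfl⟩)
    rw [logEuclideanDiv, hlog, hval, hval', EReal.coe_le_coe_iff]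
    gcongr
    refine hM.2 ?_
    rintro _ ⟨τ, hτ, rfl⟩
    rw [gibbsObjective_kronecker hα hρ hτ.1 hτ₀.1.reduceSnd (hsupp τ hτ)]
    exact mul_le_mul_of_nonpos_left (hsaddle τ hτ).2.2 (by linarith)
  · rw [logEuclideanDiv]
    -- Lower bound for arbitrary `σ`: test with `τ₀`, for which `τ₀_B` is the best choice. If the
    -- supports are not nested, the divergence is infinite.
    by_cases hsupp : supp ρ ≤ supp (reduceFst ρ ⊗ₖ σ)
    · obtain ⟨M, hM, hlog⟩ := exists_isLUB_log2_logEuclideanQ hα hρ (hA.kronecker hσ.1) hsupp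
      rw [hlog, hval, hval', EReal.coe_le_coe_iff]
      gcongr
      have hτσ := hτ₀.2.trans hsupp
      refine le_trans ?_ (hM.1 ⟨τ₀, hτ₀, rfl⟩)
      rw [gibbsObjective_kronecker hα hρ hτ₀.1 hσ hτσ]
      refine mul_le_mul_of_nonpos_left ?_ (by linarith)
      rw [hv, ← relEntDiff_reduceSnd, relEntDiff, relEntDiff]
      gcongr
      exact hτ₀.1.reduceSnd.traceLog_le hσ
        ((supp_le_kronecker_iff hA.1 hσ.1.1 hτ₀.1.1).mp hτσ).2
    · rw [log2_logEuclideanQ_eq_top hα hρ (hA.kronecker hσ.1) hsupp,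
        EReal.coe_mul_top_of_pos (by positivity)]
      exact le_top

end Saddle

/-! ### Minimax by separation in the plane -/

section Minimax

/-- Minimax theorem for the maximum of two convex functions. -/
theorem exists_convex_combination_ge {E : Type*} [AddCommGroup E] [Module ℝ E] {K : Set E}
    (hK : K.Nonempty) {f g : E → ℝ} (hf : ConvexOn ℝ K f) (hg : ConvexOn ℝ K g) {m : ℝ}
    (hm : ∀ x ∈ K, m ≤ max (f x) (g x)) :
    ∃ s, 0 ≤ s ∧ s ≤ 1 ∧ ∀ x ∈ K, m ≤ (1 - s) * f x + s * g x := by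
  have hS : Convex ℝ (Set.Iio m ×ˢ Set.Iio m) := (convex_Iio m).prod (convex_Iio m)
  have hT : Convex ℝ {p : ℝ × ℝ | ∃ x ∈ K, f x ≤ p.1 ∧ g x ≤ p.2} := by
    rintro p ⟨x, hx, hx1, hx2⟩ p' ⟨y, hy, hy1, hy2⟩ a b ha hb hab
    refine ⟨a • x + b • y, hf.1 hx hy ha hb hab, (hf.2 hx hy ha hb hab).trans ?_,
      (hg.2 hx hy ha hb hab).trans ?_⟩ <;>
    · simp only [smul_eq_mul, Prod.fst_add, Prod.smul_fst, Prod.snd_add, Prod.smul_snd]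
      gcongr
  -- The hypothesis says that the open quadrant below `(m, m)` misses the upward closure of the
  -- image of `(f, g)`; the normalised separating functional supplies the weights.
  have hdisj : Disjoint (Set.Iio m ×ˢ Set.Iio m)
      {p : ℝ × ℝ | ∃ x ∈ K, f x ≤ p.1 ∧ g x ≤ p.2} := by
    rw [Set.disjoint_left]
    rintro p ⟨h1, h2⟩ ⟨x, hx, hx1, hx2⟩
    exact absurd (hm x hx) (not_le.mpr (max_lt (hx1.trans_lt h1) (hx2.trans_lt h2)))
  obtain ⟨φ, u, hφS, hφT⟩ := geometric_hahn_banach_open hS (isOpen_Iio.prod isOpen_Iio) hT hdisj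
  set c := φ (1, 0) with hc
  set d := φ (0, 1) with hd
  have hφ : ∀ a b : ℝ, φ (a, b) = a * c + b * d := by
    intro a b
    have : (a, b) = a • ((1 : ℝ), (0 : ℝ)) + b • ((0 : ℝ), (1 : ℝ)) := by simp
    rw [this, map_add, map_smul, map_smul, smul_eq_mul, smul_eq_mul]
  have hS' : ∀ a b : ℝ, a < m → b < m → a * c + b * d < u := fun a b ha hb => by
    rw [← hφ]; exact hφS (a, b) ⟨ha, hb⟩
  have hT' : ∀ x ∈ K, ∀ a b : ℝ, f x ≤ a → g x ≤ b → u ≤ a * c + b * d := fun x hx a b ha hb => by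
    rw [← hφ]; exact hφT (a, b) ⟨x, hx, ha, hb⟩
  obtain ⟨x₀, hx₀⟩ := hK
  have hc0 : 0 ≤ c := by
    by_contra hneg
    push Not at hneg
    -- The upward closure permits this increase of the first coordinate, which for negative `c`
    -- would lower the functional to at most `u - 1`.
    have h := hT' x₀ hx₀ (f x₀ + max 0 ((u - 1 - (f x₀ * c + g x₀ * d)) / c)) (g x₀)
      (le_add_of_nonneg_right (le_max_left _ _)) le_rfl
    have h1 := mul_le_mul_of_nonpos_right
      (le_max_right 0 ((u - 1 - (f x₀ * c + g x₀ * d)) / c)) hneg.le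
    rw [div_mul_cancel₀ _ hneg.ne] at h1
    linarith
  have hd0 : 0 ≤ d := by
    by_contra hneg
    push Not at hneg
    have h := hT' x₀ hx₀ (f x₀) (g x₀ + max 0 ((u - 1 - (f x₀ * c + g x₀ * d)) / d))
      le_rfl (le_add_of_nonneg_right (le_max_left _ _))
    have h1 := mul_le_mul_of_nonpos_right
      (le_max_right 0 ((u - 1 - (f x₀ * c + g x₀ * d)) / d)) hneg.le
    rw [div_mul_cancel₀ _ hneg.ne] at h1
    linarith
  have hcd : 0 < c + d := by
    by_contra hcon
    have h1 : c = 0 := by linarith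
    have h2 : d = 0 := by linarith
    have h3 := hS' (m - 1) (m - 1) (by linarith) (by linarith)
    have h4 := hT' x₀ hx₀ _ _ le_rfl le_rfl
    rw [h1, h2] at h3 h4
    linarith
  have hmu : m * (c + d) ≤ u := by
    refine le_of_forall_pos_lt_add fun ε hε => ?_
    have h := hS' (m - ε / (c + d)) (m - ε / (c + d)) (by simp; positivity) (by simp; positivity)
    have h1 : (m - ε / (c + d)) * c + (m - ε / (c + d)) * d = m * (c + d) - ε := by
      field_simp
    linarith
  refine ⟨d / (c + d), by positivity, by rw [div_le_one hcd]; linarith, fun x hx => ?_⟩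
  have h1 : (1 - d / (c + d)) * f x + d / (c + d) * g x = (f x * c + g x * d) / (c + d) := by
    field_simp
    ring
  rw [h1, le_div_iff₀ hcd]
  exact hmu.trans (hT' x hx _ _ le_rfl le_rfl)

theorem convexOn_pi_sum {T E : Type*} [Fintype T] [AddCommGroup E] [Module ℝ E] {K : T → Set E}
    {F : T → E → ℝ} {q : T → ℝ} (hq : ∀ t, 0 ≤ q t) (hF : ∀ t, ConvexOn ℝ (K t) (F t)) :
    ConvexOn ℝ {x : T → E | ∀ t, x t ∈ K t} fun x => ∑ t, q t * F t (x t) := by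
  refine ⟨fun x hx y hy a b ha hb hab t => (hF t).1 (hx t) (hy t) ha hb hab,
    fun x hx y hy a b ha hb hab => ?_⟩
  simp only [smul_eq_mul, Finset.mul_sum]
  rw [← Finset.sum_add_distrib]
  refine Finset.sum_le_sum fun t _ => ?_
  have := mul_le_mul_of_nonneg_left ((hF t).2 (hx t) (hy t) ha hb hab) (hq t)
  simp only [smul_eq_mul] at this
  simp only [Pi.add_apply, Pi.smul_apply]
  linarith

theorem coe_finset_sum {T : Type*} (S : Finset T) (f : T → ℝ) :
    ((∑ t ∈ S, f t : ℝ) : EReal) = ∑ t ∈ S, (f t : EReal) :=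
  map_sum (⟨⟨Real.toEReal, EReal.coe_zero⟩, EReal.coe_add⟩ : ℝ →+ EReal) f S

end Minimax

end QInfo

namespace QInfo

/-! ### The Lagrangian and the exchange of supremum and infimum -/

section Exponent

open Matrix

variable {A A' B T : Type*} [Fintype A] [DecidableEq A] [Fintype A']
  [Fintype B] [DecidableEq B] [Fintype T]

/-- The relaxed exponent of a family of states, as a real number. -/
noncomputable def relaxedExponent (R : ℝ) (q : T → ℝ) (ρ τ : T → Matrix (A × B) (A × B) ℂ) : ℝ :=
  max 0 (R - ∑ t, q t * mutualInfo (ρ t) (τ t)) + ∑ t, q t * relEnt (ρ t) (τ t)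

/-- The Lagrangian of the exponent, as a real number. -/
noncomputable def exponentLagrangian (R : ℝ) (q : T → ℝ) (s : ℝ)
    (ρ τ : T → Matrix (A × B) (A × B) ℂ) : ℝ :=
  s * R + ∑ t, q t * (relEnt (ρ t) (τ t) - s * mutualInfo (ρ t) (τ t))

theorem exponentLagrangian_eq (R : ℝ) (q : T → ℝ) (s : ℝ)
    (ρ τ : T → Matrix (A × B) (A × B) ℂ) :
    exponentLagrangian R q s ρ τ
      = s * (R - ∑ t, q t * mutualInfo (ρ t) (τ t)) + ∑ t, q t * relEnt (ρ t) (τ t) := by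
  have h : ∑ t, q t * (s * mutualInfo (ρ t) (τ t)) = s * ∑ t, q t * mutualInfo (ρ t) (τ t) := by
    rw [Finset.mul_sum]
    exact Finset.sum_congr rfl fun t _ => by ring
  rw [exponentLagrangian]
  simp only [mul_sub, Finset.sum_sub_distrib, h]
  ring

theorem exponentLagrangian_le_relaxedExponent (R : ℝ) (q : T → ℝ) {s : ℝ} (hs : 0 ≤ s)
    (hs1 : s ≤ 1) (ρ τ : T → Matrix (A × B) (A × B) ℂ) :
    exponentLagrangian R q s ρ τ ≤ relaxedExponent R q ρ τ := by
  rw [exponentLagrangian_eq, relaxedExponent]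
  gcongr
  rcases le_total 0 (R - ∑ t, q t * mutualInfo (ρ t) (τ t)) with h | h
  · exact le_max_of_le_right (mul_le_of_le_one_left h hs1)
  · exact le_max_of_le_left (mul_nonpos_of_nonneg_of_nonpos hs h)

theorem exists_isMinOn_relaxedExponent (R : ℝ) (q : T → ℝ)
    {ρ : T → Matrix (A × B) (A × B) ℂ} (hρ : ∀ t, IsState (ρ t)) :
    ∃ τ ∈ {τ : T → Matrix (A × B) (A × B) ℂ | ∀ t, τ t ∈ supportedStates (ρ t)},
      IsMinOn (relaxedExponent R q ρ)
        {τ : T → Matrix (A × B) (A × B) ℂ | ∀ t, τ t ∈ supportedStates (ρ t)} τ := by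
  refine (isCompact_pi_infinite fun t => isCompact_supportedStates (hρ t).1.1).exists_isMinOn
    ⟨ρ, fun t => ⟨hρ t, le_rfl⟩⟩ ?_
  have h : ∀ (F : T → Matrix (A × B) (A × B) ℂ → ℝ),
      (∀ t, ContinuousOn (F t) (supportedStates (ρ t))) →
      ContinuousOn (fun τ : T → Matrix (A × B) (A × B) ℂ => ∑ t, q t * F t (τ t))
        {τ | ∀ t, τ t ∈ supportedStates (ρ t)} := fun F hF =>
    continuousOn_finsetSum _ fun t _ => ContinuousOn.const_mul
      ((hF t).comp (s := {τ : T → Matrix (A × B) (A × B) ℂ | ∀ t, τ t ∈ supportedStates (ρ t)})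
        (continuous_apply t).continuousOn fun τ hτ => hτ t) _
  exact (ContinuousOn.sup continuousOn_const (continuousOn_const.sub
    (h _ fun t => continuousOn_mutualInfo (ρ t)))).add (h _ fun t => continuousOn_relEnt (ρ t))

/-- Since `x_+ + y = max(y, x + y)`, the relaxed exponent is the maximum of the Lagrangians at `s =
0` and `s = 1`, both convex. Their convex combination with weight `s` is the Lagrangian at `s`. -/
theorem exists_le_exponentLagrangian (R : ℝ) {q : T → ℝ} (hq : ∀ t, 0 ≤ q t)
    {ρ : T → Matrix (A × B) (A × B) ℂ} (hρ : ∀ t, IsState (ρ t)) {m : ℝ}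
    (hm : ∀ τ : T → Matrix (A × B) (A × B) ℂ, (∀ t, τ t ∈ supportedStates (ρ t)) →
      m ≤ relaxedExponent R q ρ τ) :
    ∃ s, 0 ≤ s ∧ s ≤ 1 ∧ ∀ τ : T → Matrix (A × B) (A × B) ℂ,
      (∀ t, τ t ∈ supportedStates (ρ t)) → m ≤ exponentLagrangian R q s ρ τ := by
  have hf := convexOn_pi_sum hq fun t => convexOn_relEnt (ρ t)
  have hg := (convexOn_pi_sum hq fun t => convexOn_relEnt_sub_mutualInfo (ρ t)).add
    (convexOn_const R (convexOn_pi_sum hq fun t => convexOn_relEnt (ρ t)).1)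
  obtain ⟨s, hs, hs1, h⟩ := exists_convex_combination_ge
    ⟨ρ, fun t => ⟨hρ t, le_rfl⟩⟩ hf hg (m := m) fun τ hτ => by
      refine (hm τ hτ).trans_eq ?_
      rw [relaxedExponent, max_add, zero_add]
      congr 1
      simp only [Pi.add_apply, mul_sub, Finset.sum_sub_distrib]
      ring
  refine ⟨s, hs, hs1, fun τ hτ => (h τ hτ).trans_eq ?_⟩
  rw [exponentLagrangian_eq]
  simp only [Pi.add_apply, mul_sub, Finset.sum_sub_distrib]
  ring

theorem exponentLagrangian_convex_combination (R : ℝ) (q : T → ℝ) (s s' δ : ℝ)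
    (ρ τ : T → Matrix (A × B) (A × B) ℂ) :
    exponentLagrangian R q ((1 - δ) * s + δ * s') ρ τ
      = (1 - δ) * exponentLagrangian R q s ρ τ + δ * exponentLagrangian R q s' ρ τ := by
  simp only [exponentLagrangian_eq]
  ring

/-- For fixed `α`, the exponent is the minimum of the Lagrangian. -/
theorem exists_exponent_eq_lagrangian {N : Matrix A' A' ℂ →ₗ[ℂ] Matrix B B ℂ}
    (hN : IsChannel N) {q : T → ℝ} (hq : ∀ t, 0 ≤ q t) {ψ : T → Matrix (A × A') (A × A') ℂ}
    (hψ : ∀ t, IsState (ψ t)) (R : ℝ) {α : ℝ} (hα : 1 < α) :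
    ∃ τ₀ ∈ feasible N ψ,
      (∀ τ ∈ feasible N ψ, exponentLagrangian R q ((α - 1) / α) (fun t => applySnd N (ψ t)) τ₀
        ≤ exponentLagrangian R q ((α - 1) / α) (fun t => applySnd N (ψ t)) τ) ∧
      (((α - 1) / α : ℝ) : EReal) * ((R : EReal) - logEuclideanInfo α N q ψ)
        = (exponentLagrangian R q ((α - 1) / α) (fun t => applySnd N (ψ t)) τ₀ : ℝ) := by
  choose τ₀ hτ₀ hmin hinfo using fun t =>
    exists_iInf_logEuclideanDiv_eq (hN.isState_applySnd (hψ t)) hα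
  refine ⟨τ₀, hτ₀, fun τ hτ => ?_, ?_⟩
  · unfold exponentLagrangian
    refine add_le_add_right (Finset.sum_le_sum fun t _ => ?_) _
    exact mul_le_mul_of_nonneg_left (hmin t _ (hτ t)) (hq t)
  · have h0 : α ≠ 0 := by linarith
    have h1 : α - 1 ≠ 0 := by linarith
    simp only [hN.reduceFst_applySnd] at hinfo
    simp only [logEuclideanInfo, hinfo, ← EReal.coe_mul, ← coe_finset_sum, ← EReal.coe_sub]
    rw [EReal.coe_eq_coe_iff, exponentLagrangian, mul_sub, sub_eq_add_neg, Finset.mul_sum,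
      ← Finset.sum_neg_distrib]
    congr 1
    refine Finset.sum_congr rfl fun t _ => ?_
    have h2 : (α - 1) / α * (α / (α - 1)) = 1 := by field_simp
    linear_combination (q t * (relEnt (applySnd N (ψ t)) (τ₀ t)
      - (α - 1) / α * mutualInfo (applySnd N (ψ t)) (τ₀ t))) * h2

/-- Feasibility makes both relative entropies finite, so the extended-real objective is a real
number. -/
theorem objective_eq_relaxedExponent {N : Matrix A' A' ℂ →ₗ[ℂ] Matrix B B ℂ}
    (hN : IsChannel N) (q : T → ℝ) {ψ : T → Matrix (A × A') (A × A') ℂ}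
    (hψ : ∀ t, IsState (ψ t)) (R : ℝ) {τ : T → Matrix (A × B) (A × B) ℂ}
    (hτ : τ ∈ feasible N ψ) :
    max 0 ((R : EReal) - ∑ t, (q t : EReal) *
        relEntropy (τ t) (reduceFst (ψ t) ⊗ₖ reduceSnd (τ t))) +
      ∑ t, (q t : EReal) * relEntropy (τ t) (applySnd N (ψ t))
      = (relaxedExponent R q (fun t => applySnd N (ψ t)) τ : ℝ) := by
  have h1 : ∀ t, relEntropy (τ t) (reduceFst (ψ t) ⊗ₖ reduceSnd (τ t))
      = (mutualInfo (applySnd N (ψ t)) (τ t) : ℝ) := fun t => by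
    rw [← relEntropy_eq_mutualInfo (hN.isState_applySnd (hψ t)) (hτ t), hN.reduceFst_applySnd]
  have h2 : ∀ t, relEntropy (τ t) (applySnd N (ψ t)) = (relEnt (applySnd N (ψ t)) (τ t) : ℝ) :=
    fun t => relEntropy_eq_relEnt (hτ t).2
  simp only [h1, h2, ← EReal.coe_mul, ← coe_finset_sum, ← EReal.coe_sub]
  rw [← EReal.coe_zero, ← EReal.coe_strictMono.monotone.map_max, ← EReal.coe_add,
    relaxedExponent]

end Exponent

end QInfo

theorem mainTheorem5 {A A' B T : Type*} [Fintype A] [DecidableEq A] [Fintype A']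
    [Fintype B] [DecidableEq B] [Fintype T]
    (N : Matrix A' A' ℂ →ₗ[ℂ] Matrix B B ℂ) (hN : QInfo.IsChannel N)
    (q : T → ℝ) (hq : ∀ t, 0 ≤ q t) (hq1 : ∑ t, q t = 1)
    (ψ : T → Matrix (A × A') (A × A') ℂ) (hψ : ∀ t, QInfo.IsState (ψ t))
    (R : ℝ) (hR : 0 ≤ R) :
    QInfo.exponentF N R q ψ =
      ⨅ τ ∈ QInfo.feasible N ψ,
        (max 0 ((R : EReal) -
            ∑ t, (q t : EReal) *
              QInfo.relEntropy (τ t) (QInfo.reduceFst (ψ t) ⊗ₖ QInfo.reduceSnd (τ t))) +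
          ∑ t, (q t : EReal) * QInfo.relEntropy (τ t) (QInfo.applySnd N (ψ t))) := by
  have hρ := fun t => hN.isState_applySnd (hψ t)
  refine le_antisymm (iSup₂_le fun α hα => le_iInf₂ fun τ hτ => ?_) ?_
  · obtain ⟨τ₀, hτ₀, hmin, heq⟩ := QInfo.exists_exponent_eq_lagrangian hN hq hψ R hα
    rw [heq, QInfo.objective_eq_relaxedExponent hN q hψ R hτ, EReal.coe_le_coe_iff]
    have hα0 : 0 < α := by linarith
    exact (hmin τ hτ).trans (QInfo.exponentLagrangian_le_relaxedExponent R q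
      (div_nonneg (by linarith) hα0.le) (by rw [div_le_one hα0]; linarith) _ τ)
  · obtain ⟨τ₁, hτ₁, hmin⟩ := QInfo.exists_isMinOn_relaxedExponent R q hρ
    refine (iInf₂_le τ₁ hτ₁).trans ?_
    rw [QInfo.objective_eq_relaxedExponent hN q hψ R hτ₁]
    set m := QInfo.relaxedExponent R q (fun t => QInfo.applySnd N (ψ t)) τ₁
    obtain ⟨s, hs, hs1, hsm⟩ := QInfo.exists_le_exponentLagrangian R hq hρ (m := m)
      fun τ hτ => hmin hτ
    -- The choice `α = 2`, that is `s = 1/2`, only provides a finite lower bound `c` for the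
    -- Lagrangian at an interior parameter.
    obtain ⟨τ₂, -, hmin₂, -⟩ :=
      QInfo.exists_exponent_eq_lagrangian hN hq hψ R (one_lt_two (α := ℝ))
    set c := QInfo.exponentLagrangian R q ((2 - 1) / 2) (fun t => QInfo.applySnd N (ψ t)) τ₂
    -- The optimal `s` may be 0 or 1, which no finite `α > 1` attains. Mixing it with `1/2` gives an
    -- interior `s'`, reached at `α = 1 / (1 - s')`, at a cost that vanishes with `δ`.
    have key : ∀ δ : ℝ, 0 < δ → δ < 1 →
        (((1 - δ) * m + δ * c : ℝ) : EReal) ≤ QInfo.exponentF N R q ψ := by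
      intro δ hδ hδ1
      set s' : ℝ := (1 - δ) * s + δ * ((2 - 1) / 2) with hs'
      have hs'0 : 0 < s' := by
        have : 0 ≤ (1 - δ) * s := mul_nonneg (by linarith) hs
        linarith
      have hs'1 : s' < 1 := by
        have : (1 - δ) * s ≤ (1 - δ) * 1 := mul_le_mul_of_nonneg_left hs1 (by linarith)
        linarith
      have hα : 1 < 1 / (1 - s') := by
        rw [lt_div_iff₀ (by linarith)]
        linarith
      have hαs : (1 / (1 - s') - 1) / (1 / (1 - s')) = s' := by
        have : 1 - s' ≠ 0 := by linarith
        field_simp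
        ring
      obtain ⟨τ₃, hτ₃, -, heq⟩ := QInfo.exists_exponent_eq_lagrangian hN hq hψ R hα
      refine le_trans ?_ (le_iSup₂ (1 / (1 - s')) hα)
      rw [heq, hαs, EReal.coe_le_coe_iff, hs', QInfo.exponentLagrangian_convex_combination]
      exact add_le_add (mul_le_mul_of_nonneg_left (hsm τ₃ hτ₃) (by linarith))
        (mul_le_mul_of_nonneg_left (hmin₂ τ₃ hτ₃) hδ.le)
    have hlim : Tendsto (fun δ : ℝ => (((1 - δ) * m + δ * c : ℝ) : EReal)) (𝓝[>] 0)
        (𝓝 (m : EReal)) := by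
      have h1 : Continuous fun δ : ℝ => (((1 - δ) * m + δ * c : ℝ) : EReal) :=
        continuous_coe_real_ereal.comp (by fun_prop)
      have h2 := h1.tendsto 0
      simp only [sub_zero, one_mul, zero_mul, add_zero] at h2
      exact h2.mono_left nhdsWithin_le_nhds
    refine le_of_tendsto hlim ?_
    filter_upwards [Ioo_mem_nhdsGT (zero_lt_one' ℝ)] with δ hδ
    exact key δ hδ.1 hδ.2
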